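/- Let $N\ge 2$, let $\chi$ be an even Dirichlet character modulo $N$, let $\operatorname{Im}\tau>0$ and write $q=e^{2\pi i\tau}$. Put $$\theta_1(z|\tau)=2q^{1/8}\sum_{n\ge 0}(-1)^nq^{n(n+1)/2}\sin(2n+1)z\quad (q^{1/8}=e^{2\pi i\tau/8}),\qquad g(z|\tau;\chi)=\sum_{k=1}^{N-1}\chi(k)\frac{\theta_1'}{\theta_1}(z+k\pi\tau|N\tau),$$ where $'$ is the derivative in $z$. Let $\wp(z|\tau)$ be the Weierstrass function of the lattice $\pi\mathbb Z+\pi\tau\mathbb Z$, put $g_n(\chi)=\sum_{k=1}^{N-1}\chi(k)e^{2\pi i nk/N}$, and let $B_n(\chi)$ be the Taylor coefficients at $z=0$ in $$\sum_{k=1}^{N-1}\chi(k)\cot\left(z+\frac{k\pi}{N}\right)=\sum_{n\ge 0}B_n(\chi)z^n .$$ For integers $k\ge 0$ define $$E_{2k+2}(\tau,\chi)=\frac{(-1)^{k+1}2^{2k+3}}{(2k+1)!}\sum_{m,n\ge 1}n^{2k+1}\chi(m)q^{mn},$$ $$F_{2k+2}(\tau,\chi)=-B_{2k+1}(\chi)+\frac{(-1)^{k+1}2^{2k+3}}{(2k+1)!}\sum_{m,n\ge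 1}n^{2k+1}g_n(\chi)q^{mn}.$$ (1) If $\chi$ is not the principal character modulo $N$, then for all $z$ in the open disc about $0$ whose radius is the distance from $0$ to the nearest point $\pi(m/N+n\tau)$ with $m,n\in\mathbb Z$ and $\chi(m)\ne 0$, $$\frac1\tau\, g\left(\frac z\tau\Big|-\frac1{N\tau};\chi\right)=-\sum_{k=0}^\infty F_{2k+2}(\tau,\chi)z^{2k+1},$$ $$\sum_{k=1}^{N-1}\chi(k)\,\wp\left(z+\frac{k\pi}N\Big|\tau\right)=\sum_{k=0}^\infty(2k+1)F_{2k+2}(\tau,\chi)z^{2k},$$ and, for every integer $k\ge 0$, $F_{2k+2}(\tau,\chi)=\tau^{-2k-2}E_{2k+2}\left(-\frac1{N\tau},\chi\right)$. (2) For every even $\chi$ modulo $N$ and every integer $k\ge 1$, $$F_{2k+2}(\tau,\chi)=\frac1{\pi^{2k+2}}\sum_{m,n=-\infty}^\infty\frac{\chi(m)}{(m/N+n\tau)^{2k+2}}=\frac1{\tau^{2k+2}}E_{2k+2}\left(-\frac1{N\tau},\chi\right),$$ where the double series converges absolutely. -/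

import Mathlib

namespace EvenChar

open Complex

noncomputable section

/-- `q = exp(2πiτ)`. -/
def q (τ : ℂ) : ℂ := cexp (2 * Real.pi * I * τ)

/-- Jacobi's `θ₁(z|τ) = 2 q^{1/8} ∑_{n ≥ 0} (-1)^n q^{n(n+1)/2} sin((2n+1)z)`, where
`q^{1/8} = exp(2πiτ/8)`; the division of exponents is exact. -/
def theta1 (z τ : ℂ) : ℂ :=
  2 * cexp (2 * Real.pi * I * τ / 8) *
    ∑' n : ℕ, (-1) ^ n * q τ ^ (n * (n + 1) / 2) * Complex.sin ((2 * n + 1) * z)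

/-- The logarithmic derivative `(θ₁'/θ₁)(z|τ)` in the variable `z`. -/
def theta1LogDeriv (z τ : ℂ) : ℂ := logDeriv (fun w => theta1 w τ) z

/-- `g(z|τ;χ) = ∑_{k=1}^{N-1} χ(k) (θ₁'/θ₁)(z + kπτ | Nτ)`. -/
def g {N : ℕ} (χ : DirichletCharacter ℂ N) (z τ : ℂ) : ℂ :=
  ∑ k ∈ Finset.Icc 1 (N - 1), χ (k : ZMod N) * theta1LogDeriv (z + k * Real.pi * τ) (N * τ)

/-- The Gauss sum `g_n(χ) = ∑_{k=1}^{N-1} χ(k) exp(2πink/N)`. -/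
def gaussSum {N : ℕ} (χ : DirichletCharacter ℂ N) (n : ℕ) : ℂ :=
  ∑ k ∈ Finset.Icc 1 (N - 1), χ (k : ZMod N) * cexp (2 * I * Real.pi * n * k / N)

/-- The Taylor coefficients `B_n(χ)` at `z = 0` of `∑_{k=1}^{N-1} χ(k) cot(z + kπ/N)`. -/
def B {N : ℕ} (χ : DirichletCharacter ℂ N) (n : ℕ) : ℂ :=
  iteratedDeriv n
    (fun z : ℂ => ∑ k ∈ Finset.Icc 1 (N - 1),
      χ (k : ZMod N) * Complex.cot (z + k * Real.pi / N)) 0 / (n.factorial : ℂ)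

/-- `eisE χ τ k` is the series `E_{2k+2}(τ,χ)`
`= (-1)^{k+1} 2^{2k+3} / (2k+1)! * ∑_{m,n ≥ 1} n^{2k+1} χ(m) q^{mn}`. -/
def eisE {N : ℕ} (χ : DirichletCharacter ℂ N) (τ : ℂ) (k : ℕ) : ℂ :=
  (-1) ^ (k + 1) * 2 ^ (2 * k + 3) / ((2 * k + 1).factorial : ℂ) *
    ∑' p : ℕ+ × ℕ+, ((p.2 : ℕ) : ℂ) ^ (2 * k + 1) * χ ((p.1 : ℕ) : ZMod N) *
      q τ ^ ((p.1 : ℕ) * (p.2 : ℕ))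

/-- `eisF χ τ k` is the series `F_{2k+2}(τ,χ)`
`= - B_{2k+1}(χ) + (-1)^{k+1} 2^{2k+3} / (2k+1)! * ∑_{m,n ≥ 1} n^{2k+1} g_n(χ) q^{mn}`. -/
def eisF {N : ℕ} (χ : DirichletCharacter ℂ N) (τ : ℂ) (k : ℕ) : ℂ :=
  -B χ (2 * k + 1) +
    (-1) ^ (k + 1) * 2 ^ (2 * k + 3) / ((2 * k + 1).factorial : ℂ) *
      ∑' p : ℕ+ × ℕ+, ((p.2 : ℕ) : ℂ) ^ (2 * k + 1) * gaussSum χ (p.2 : ℕ) *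
        q τ ^ ((p.1 : ℕ) * (p.2 : ℕ))

/-- The periods `π` and `πτ`. -/
def periods (τ : UpperHalfPlane) : PeriodPair where
  ω₁ := Real.pi
  ω₂ := Real.pi * (τ : ℂ)
  indep := by
    rw [LinearIndependent.pair_iff]
    intro s t h
    have hpi := Real.pi_ne_zero
    have him := congrArg Complex.im h
    have hre := congrArg Complex.re h
    simp [hpi, τ.im_ne_zero] at him
    subst him
    simp [hpi] at hre
    exact ⟨hre, rfl⟩

/-- The Weierstrass function `℘(z|τ)` with period lattice `πℤ + πτℤ`. -/
def wp (z : ℂ) (τ : UpperHalfPlane) : ℂ := (periods τ).weierstrassP z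

/-- `z` is strictly closer to `0` than every point `π(m/N + nτ)`, `m n : ℤ`, with `χ(m) ≠ 0`:
the open disc about `0` that reaches to the nearest of these points. -/
def InDisc {N : ℕ} (χ : DirichletCharacter ℂ N) (τ : UpperHalfPlane) (z : ℂ) : Prop :=
  ∀ m n : ℤ, χ (m : ZMod N) ≠ 0 → ‖z‖ < ‖(Real.pi : ℂ) * ((m : ℂ) / N + n * (τ : ℂ))‖

end

end EvenChar

/-!
Everything is reduced to the sums over lattice cells
`V_k = ∑_{j, n ∈ ℤ} ∑_{r=1}^{N-1} χ(r) (r/N + j + nτ)^{-(2k+2)}` (`EvenChar.cellSum`). The outer double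
series converges absolutely for `k ≥ 1`, and also for `k = 0` when `χ` is not principal: then
`∑ χ(r) = 0`, and the sum is `π²` times the value at `0` of `∑ χ(r) ℘(z + rπ/N | τ)`, whose defining
series is absolutely convergent (`hasSum_cellSum`). Hence `V_k` may be computed in two ways. Summing over `j`
first, the row `n = 0` gives the Taylor coefficient of the cotangent sum by partial fractions, the
other rows are evaluated by the Lipschitz formula, and `V_k = π^{2k+2} F_{2k+2}(τ, χ)`
(`eq_eisF_of_hasSum`). Summing over `n` first, the Lipschitz formula at `-m/(Nτ)` gives
`V_k = (π/τ)^{2k+2} E_{2k+2}(-1/(Nτ), χ)` (`eq_eisE_of_hasSum`). This is the transformation formula,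
and for `k ≥ 1` splitting the cells gives the double series over all `m, n` (`hasSum_pairs`).

The Taylor coefficients of `℘` at `rπ/N` are sums over the lattice, and the `χ`-weighted sum of
those of degree `2k` is `(2k+1) V_k / π^{2k+2}`; the odd ones cancel because `χ` is even. This is the
expansion of `∑ χ(r) ℘(z + rπ/N | τ)` (`hasSum_wp`).

For `g` the Jacobi triple product is needed. It is the limit of the finite identity
`sin z ∏_{k=1}^m (1 - 2 q^k cos 2z + q^{2k}) = ∑_n (-1)^n q^{n(n+1)/2} [2m+1, m-n]_q sin (2n+1)z`
with Gaussian binomial coefficients. It shows that `θ₁` has no zeros outside the lattice, so that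
`g(z/τ | -1/(Nτ); χ)` is holomorphic on the disc, and that `θ₁'/θ₁` is a Lambert series, so that
`g(w|T; χ) = 4 ∑_{m, n ≥ 1} χ(m) q^{mn} sin 2nw` near `w = 0`, where `q = e^{2πiT}`. Hence the
Taylor coefficients of `g(·|T; χ)` are `-E_{2k+2}(T, χ)` (`eventually_hasSum_g`), and the
transformation formula turns them into `-F_{2k+2}(τ, χ)`.
-/

open Complex Filter Topology

namespace EvenChar

noncomputable section

/-! ### A finite form of the Jacobi triple product -/

/-- The `q`-Pochhammer symbol `(q; q)_n = ∏_{i=1}^n (1 - q^i)`. -/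
def qPoch (q : ℂ) (n : ℕ) : ℂ := ∏ i ∈ Finset.range n, (1 - q ^ (i + 1))

/-- The Gaussian binomial coefficient with upper entry `2m + 1` and lower entry `m - n`, extended
by zero to `n > m`. -/
def thetaCoeff (q : ℂ) (m n : ℕ) : ℂ :=
  if n ≤ m then qPoch q (2 * m + 1) / (qPoch q (m - n) * qPoch q (m + n + 1)) else 0

lemma triangle_succ (n : ℕ) : (n + 1) * (n + 1 + 1) / 2 = n * (n + 1) / 2 + (n + 1) := by
  rw [show (n + 1) * (n + 1 + 1) = n * (n + 1) + 2 * (n + 1) by ring]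
  omega

lemma qPoch_succ (q : ℂ) (n : ℕ) : qPoch q (n + 1) = qPoch q n * (1 - q ^ (n + 1)) :=
  Finset.prod_range_succ _ _

lemma one_sub_pow_succ_ne_zero {q : ℂ} (hq : ‖q‖ < 1) (n : ℕ) : 1 - q ^ (n + 1) ≠ 0 := by
  intro h
  have h1 : ‖q ^ (n + 1)‖ = 1 := by rw [← sub_eq_zero.mp h, norm_one]
  have h2 : ‖q ^ (n + 1)‖ < 1 := by
    rw [norm_pow]; exact pow_lt_one₀ (norm_nonneg _) hq (Nat.succ_ne_zero n)
  exact h2.ne h1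

lemma qPoch_ne_zero {q : ℂ} (hq : ‖q‖ < 1) (n : ℕ) : qPoch q n ≠ 0 :=
  Finset.prod_ne_zero_iff.mpr fun i _ => one_sub_pow_succ_ne_zero hq i

lemma thetaCoeff_of_lt (q : ℂ) {m n : ℕ} (h : m < n) : thetaCoeff q m n = 0 :=
  if_neg (by omega)

lemma thetaCoeff_add {q : ℂ} (a n : ℕ) : thetaCoeff q (n + a) n =
    qPoch q (2 * n + 2 * a + 1) / (qPoch q a * qPoch q (2 * n + a + 1)) := by
  rw [thetaCoeff, if_pos (by omega)]
  congr 2 <;> congr 1 <;> omega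

/-- The boundary case of `thetaCoeff_succ_succ`: the term with index `-1` is folded back to `0`. -/
lemma thetaCoeff_succ_zero {q : ℂ} (hq : ‖q‖ < 1) (m : ℕ) : thetaCoeff q (m + 1) 0 =
    (1 + q ^ (2 * m + 2) + q ^ (m + 1)) * thetaCoeff q m 0 +
      q ^ (m + 2) * thetaCoeff q m 1 := by
  have hP := qPoch_ne_zero hq
  have hf := one_sub_pow_succ_ne_zero hq
  rcases m with _ | a
  · rw [thetaCoeff_of_lt q zero_lt_one]
    simp only [thetaCoeff, qPoch, Finset.prod_range_succ, Finset.prod_range_zero]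
    have h0 := hf 0
    have h1 := hf 1
    simp at h0 h1 ⊢
    field_simp
    ring
  · have e0 := thetaCoeff_add (q := q) (a + 1 + 1) 0
    have e1 := thetaCoeff_add (q := q) (a + 1) 0
    have e2 := thetaCoeff_add (q := q) a 1
    simp only [zero_add, mul_zero, add_comm 1 a] at e0 e1 e2
    rw [e0, e1, e2]
    have r1 : qPoch q (2 * (a + 1 + 1) + 1) = qPoch q (2 * (a + 1) + 1) *
        (1 - q ^ (2 * (a + 1) + 1 + 1)) * (1 - q ^ (2 * (a + 1) + 1 + 1 + 1)) := by
      rw [← qPoch_succ, ← qPoch_succ]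
      congr 1
    have r2 : qPoch q (2 * 1 + 2 * a + 1) = qPoch q (2 * (a + 1) + 1) := by congr 1; ring
    have r3 : qPoch q (2 * 1 + a + 1) = qPoch q a * (1 - q ^ (a + 1)) * (1 - q ^ (a + 1 + 1)) *
        (1 - q ^ (a + 1 + 1 + 1)) := by
      rw [← qPoch_succ, ← qPoch_succ, ← qPoch_succ]
      congr 1; ring
    rw [r1, r2, r3]
    simp only [qPoch_succ]
    have h0 := hP a
    have h1 := hP (2 * (a + 1))
    have h3 := hf (a + 1)
    have h4 := hf (a + 1 + 1)
    field_simp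
    ring

/-- The recurrence for the coefficients of the finite product; the truncated exponent `m - n` is
harmless since `thetaCoeff q m n = 0` for `m < n`. -/
lemma thetaCoeff_succ_succ {q : ℂ} (hq : ‖q‖ < 1) (m n : ℕ) : thetaCoeff q (m + 1) (n + 1) =
    (1 + q ^ (2 * m + 2)) * thetaCoeff q m (n + 1) + q ^ (m - n) * thetaCoeff q m n +
      q ^ (m + n + 3) * thetaCoeff q m (n + 2) := by
  have hP := qPoch_ne_zero hq
  have hf := one_sub_pow_succ_ne_zero hq
  rcases lt_trichotomy m n with h | rfl | h
  · simp [thetaCoeff_of_lt q h, thetaCoeff_of_lt q (show m < n + 1 by omega),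
      thetaCoeff_of_lt q (show m < n + 2 by omega),
      thetaCoeff_of_lt q (show m + 1 < n + 1 by omega)]
  · rw [thetaCoeff_of_lt q (show m < m + 1 by omega), thetaCoeff_of_lt q (show m < m + 2 by omega)]
    have e0 := thetaCoeff_add (q := q) 0 (m + 1)
    have e1 := thetaCoeff_add (q := q) 0 m
    simp only [add_zero, mul_zero] at e0 e1
    rw [e0, e1, div_mul_cancel_right₀ (hP _), div_mul_cancel_right₀ (hP _)]
    simp
  · obtain ⟨a, rfl⟩ : ∃ a, m = n + 1 + a := ⟨m - n - 1, by omega⟩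
    have e0 := thetaCoeff_add (q := q) (a + 1) (n + 1)
    have e1 := thetaCoeff_add (q := q) a (n + 1)
    have e2 := thetaCoeff_add (q := q) (a + 1) n
    rw [show n + 1 + (a + 1) = n + 1 + a + 1 by ring] at e0
    rw [show n + (a + 1) = n + 1 + a by ring] at e2
    rw [e0, e1, e2, show n + 1 + a - n = a + 1 by omega]
    have r1 : qPoch q (2 * (n + 1) + 2 * (a + 1) + 1) = qPoch q (2 * n + 2 * a + 1) *
        (1 - q ^ (2 * n + 2 * a + 1 + 1)) * (1 - q ^ (2 * n + 2 * a + 1 + 1 + 1)) *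
        (1 - q ^ (2 * n + 2 * a + 1 + 1 + 1 + 1)) * (1 - q ^ (2 * n + 2 * a + 1 + 1 + 1 + 1 + 1)) := by
      simp only [← qPoch_succ]
      congr 1; ring
    have r2 : qPoch q (2 * (n + 1) + 2 * a + 1) = qPoch q (2 * n + 2 * a + 1) *
        (1 - q ^ (2 * n + 2 * a + 1 + 1)) * (1 - q ^ (2 * n + 2 * a + 1 + 1 + 1)) := by
      simp only [← qPoch_succ]
      congr 1; ring
    have r3 : qPoch q (2 * n + 2 * (a + 1) + 1) = qPoch q (2 * n + 2 * a + 1) *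
        (1 - q ^ (2 * n + 2 * a + 1 + 1)) * (1 - q ^ (2 * n + 2 * a + 1 + 1 + 1)) := by
      simp only [← qPoch_succ]
      congr 1
    have s1 : qPoch q (2 * (n + 1) + (a + 1) + 1) = qPoch q (2 * n + a + 1 + 1) *
        (1 - q ^ (2 * n + a + 1 + 1 + 1)) * (1 - q ^ (2 * n + a + 1 + 1 + 1 + 1)) := by
      simp only [← qPoch_succ]
      congr 1; ring
    have s2 : qPoch q (2 * (n + 1) + a + 1) = qPoch q (2 * n + a + 1 + 1) *
        (1 - q ^ (2 * n + a + 1 + 1 + 1)) := by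
      simp only [← qPoch_succ]
      congr 1; ring
    have s3 : qPoch q (2 * n + (a + 1) + 1) = qPoch q (2 * n + a + 1 + 1) := by
      congr 1
    rw [r1, r2, r3, s1, s2, s3]
    rcases a with _ | a
    · rw [thetaCoeff_of_lt q (by omega)]
      have h0 := hP (2 * n + 0 + 1 + 1)
      have h1 := hP (2 * n + 2 * 0 + 1)
      have h2 := hf 0
      have h3 := hf (2 * n + 0 + 1 + 1)
      have h4 := hf (2 * n + 0 + 1 + 1 + 1)
      simp only [qPoch_succ _ 0]
      simp only [qPoch, Finset.prod_range_zero]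
      rw [← qPoch, ← qPoch]
      simp only [one_mul]
      field_simp
      ring
    · have e3 := thetaCoeff_add (q := q) a (n + 2)
      rw [show n + 2 + a = n + 1 + (a + 1) by ring] at e3
      have r4 : qPoch q (2 * (n + 2) + 2 * a + 1) = qPoch q (2 * n + 2 * (a + 1) + 1) *
        (1 - q ^ (2 * n + 2 * (a + 1) + 1 + 1)) * (1 - q ^ (2 * n + 2 * (a + 1) + 1 + 1 + 1)) := by
        simp only [← qPoch_succ]
        congr 1; ring
      have s4 : qPoch q (2 * (n + 2) + a + 1) = qPoch q (2 * n + (a + 1) + 1 + 1) *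
        (1 - q ^ (2 * n + (a + 1) + 1 + 1 + 1)) * (1 - q ^ (2 * n + (a + 1) + 1 + 1 + 1 + 1)) := by
        simp only [← qPoch_succ]
        congr 1; ring
      rw [e3, r4, s4]
      simp only [qPoch_succ _ a, qPoch_succ _ (a + 1)]
      have h0 := hP (2 * n + (a + 1) + 1 + 1)
      have h1 := hP (2 * n + 2 * (a + 1) + 1)
      have h2 := hf a
      have h5 := hf (a + 1)
      have h3 := hf (2 * n + (a + 1) + 1 + 1)
      have h4 := hf (2 * n + (a + 1) + 1 + 1 + 1)
      field_simp
      ring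

/-- A finite form of the Jacobi triple product identity. Multiplying the sine polynomial by the next
factor acts on its coefficients by the three-term recurrence `thetaCoeff_succ_succ`, because
`sin (2n+3)z + sin (2n-1)z = 2 cos 2z sin (2n+1)z`. The upper limit `K` of the sum is arbitrary
beyond `m`, where the coefficients vanish. -/
lemma sin_mul_prod_eq_sum {q : ℂ} (hq : ‖q‖ < 1) (z : ℂ) (m : ℕ) : ∀ K, m < K →
    Complex.sin z * ∏ k ∈ Finset.range m,
        (1 - 2 * q ^ (k + 1) * Complex.cos (2 * z) + q ^ (2 * (k + 1))) =
      ∑ n ∈ Finset.range K, (-1) ^ n * q ^ (n * (n + 1) / 2) * thetaCoeff q m n *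
        Complex.sin ((2 * n + 1) * z) := by
  induction m with
  | zero =>
    intro K hK
    rw [Finset.sum_eq_single 0]
    · have h := one_sub_pow_succ_ne_zero hq 0
      simp [thetaCoeff, qPoch] at h ⊢
      rw [div_self h, one_mul]
    · intro n _ hn
      rw [thetaCoeff_of_lt q (by omega)]; ring
    · intro h; simp at h; omega
  | succ m ih =>
    intro K hK
    obtain ⟨K, rfl⟩ : ∃ K', K = K' + 1 := ⟨K - 1, by omega⟩
    have hmK : m < K := by omega
    set s : ℕ → ℂ := fun n => Complex.sin ((2 * n + 1) * z) with hs
    set a : ℕ → ℂ := fun n => (-1) ^ n * q ^ (n * (n + 1) / 2) * thetaCoeff q m n with ha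
    have haz (n : ℕ) (hn : m < n) : a n = 0 := by simp [ha, thetaCoeff_of_lt q hn]
    have hs0 : s 1 - s 0 = 2 * Complex.cos (2 * z) * s 0 := by
      simp only [hs, Nat.cast_one, Nat.cast_zero, mul_zero, zero_add, one_mul, mul_one]
      rw [show (2 + 1 : ℂ) * z = 2 * z + z by ring, Complex.sin_add]
      have h := Complex.sin_sub (2 * z) z
      rw [show 2 * z - z = z by ring] at h
      linear_combination -h
    have hsn (n : ℕ) : s (n + 2) + s n = 2 * Complex.cos (2 * z) * s (n + 1) := by
      simp only [hs]
      push_cast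
      rw [show (2 * ((n : ℂ) + 2) + 1) * z = (2 * (n + 1) + 1) * z + 2 * z by ring,
        show (2 * (n : ℂ) + 1) * z = (2 * (n + 1) + 1) * z - 2 * z by ring,
        Complex.sin_add, Complex.sin_sub]
      ring
    have hb0 : (-1) ^ 0 * q ^ (0 * (0 + 1) / 2) * thetaCoeff q (m + 1) 0 =
        (1 + q ^ (2 * (m + 1))) * a 0 - q ^ (m + 1) * (a 1 - a 0) := by
      simp only [ha, thetaCoeff_succ_zero hq]
      norm_num
      ring
    have hbn (n : ℕ) : (-1) ^ (n + 1) * q ^ ((n + 1) * (n + 1 + 1) / 2) *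
          thetaCoeff q (m + 1) (n + 1) =
        (1 + q ^ (2 * (m + 1))) * a (n + 1) - q ^ (m + 1) * (a (n + 2) + a n) := by
      simp only [ha, thetaCoeff_succ_succ hq]
      rw [triangle_succ (n + 1), triangle_succ n]
      rcases le_or_gt n m with h | h
      · obtain ⟨d, rfl⟩ : ∃ d, m = n + d := ⟨m - n, by omega⟩
        rw [Nat.add_sub_cancel_left]
        ring
      · rw [thetaCoeff_of_lt q h, thetaCoeff_of_lt q (show m < n + 1 by omega),
          thetaCoeff_of_lt q (show m < n + 2 by omega)]
        ring
    have key : ∑ n ∈ Finset.range K, (a (n + 2) + a n) * s (n + 1) + (a 1 - a 0) * s 0 =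
        2 * Complex.cos (2 * z) * ∑ n ∈ Finset.range (K + 1), a n * s n := by
      have h1 : ∑ n ∈ Finset.range K, a (n + 2) * s (n + 1) + a 1 * s 0 =
          ∑ n ∈ Finset.range K, a (n + 1) * s n := by
        rw [← Finset.sum_range_succ' (fun n => a (n + 1) * s n), Finset.sum_range_succ,
          haz (K + 1) (by omega)]
        ring
      have h2 : ∑ n ∈ Finset.range K, a n * s (n + 1) =
          ∑ n ∈ Finset.range K, a (n + 1) * s (n + 2) + a 0 * s 1 := by
        rw [← Finset.sum_range_succ' (fun n => a n * s (n + 1)), Finset.sum_range_succ,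
          haz K hmK]
        ring
      have h3 : ∑ n ∈ Finset.range K, a (n + 1) * (s (n + 2) + s n) =
          2 * Complex.cos (2 * z) * ∑ n ∈ Finset.range K, a (n + 1) * s (n + 1) := by
        rw [Finset.mul_sum]
        exact Finset.sum_congr rfl fun n _ => by rw [hsn]; ring
      rw [Finset.sum_range_succ' (fun n => a n * s n)]
      simp only [mul_add, add_mul, Finset.sum_add_distrib] at h3 ⊢
      linear_combination h1 + h2 + h3 + a 0 * hs0
    rw [Finset.prod_range_succ, ← mul_assoc, ih (K + 1) (by omega),
      Finset.sum_range_succ' (fun n => (-1) ^ n * q ^ (n * (n + 1) / 2) * thetaCoeff q (m + 1) n *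
        Complex.sin ((2 * n + 1) * z))]
    simp only [hb0, hbn]
    change (∑ n ∈ Finset.range (K + 1), a n * s n) * _ = ∑ n ∈ Finset.range K,
      ((1 + q ^ (2 * (m + 1))) * a (n + 1) - q ^ (m + 1) * (a (n + 2) + a n)) * s (n + 1) +
      ((1 + q ^ (2 * (m + 1))) * a 0 - q ^ (m + 1) * (a 1 - a 0)) * s 0
    have h4 : ∑ n ∈ Finset.range K,
      ((1 + q ^ (2 * (m + 1))) * a (n + 1) - q ^ (m + 1) * (a (n + 2) + a n)) * s (n + 1) =
      (1 + q ^ (2 * (m + 1))) * ∑ n ∈ Finset.range K, a (n + 1) * s (n + 1) - 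
      q ^ (m + 1) * ∑ n ∈ Finset.range K, (a (n + 2) + a n) * s (n + 1) := by
      rw [Finset.mul_sum, Finset.mul_sum, ← Finset.sum_sub_distrib]
      exact Finset.sum_congr rfl fun n _ => by ring
    have h5 := Finset.sum_range_succ' (fun n => a n * s n) K
    rw [h4]
    linear_combination (1 + q ^ (2 * (m + 1))) * h5 + q ^ (m + 1) * key

/-! ### The product for `θ₁` and its logarithmic derivative -/

/-- The `k`-th factor `1 - 2 q^{k+1} cos 2z + q^{2(k+1)}` of the product for `θ₁`. -/
def thetaFactor (q : ℂ) (k : ℕ) (z : ℂ) : ℂ :=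
  1 + (q ^ (2 * (k + 1)) - 2 * q ^ (k + 1) * Complex.cos (2 * z))

lemma norm_q_lt_one {τ : ℂ} (hτ : 0 < τ.im) : ‖q τ‖ < 1 := by
  have h := UpperHalfPlane.norm_exp_two_pi_I_lt_one ⟨τ, hτ⟩
  simpa [q] using h

lemma q_ne_zero (τ : ℂ) : q τ ≠ 0 := Complex.exp_ne_zero _

lemma norm_cos_le (w : ℂ) : ‖Complex.cos w‖ ≤ Real.exp ‖w‖ := by
  have h1 := Complex.norm_exp_le_exp_norm (w * I)
  have h2 := Complex.norm_exp_le_exp_norm (-w * I)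
  have h3 := norm_add_le (cexp (w * I)) (cexp (-w * I))
  simp only [norm_mul, norm_neg, norm_I, mul_one] at h1 h2
  rw [Complex.cos, norm_div, Complex.norm_two]
  linarith

lemma norm_sin_le (w : ℂ) : ‖Complex.sin w‖ ≤ Real.exp ‖w‖ := by
  have h1 := Complex.norm_exp_le_exp_norm (w * I)
  have h2 := Complex.norm_exp_le_exp_norm (-w * I)
  have h3 := norm_sub_le (cexp (-w * I)) (cexp (w * I))
  simp only [norm_mul, norm_neg, norm_I, mul_one] at h1 h2
  rw [Complex.sin, norm_div, Complex.norm_two, norm_mul, norm_I]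
  linarith

lemma norm_thetaFactor_sub_one_le {q : ℂ} (hq : ‖q‖ < 1) {R : ℝ} {z : ℂ} (hz : ‖z‖ ≤ R) (k : ℕ) :
    ‖q ^ (2 * (k + 1)) - 2 * q ^ (k + 1) * Complex.cos (2 * z)‖ ≤
      ‖q‖ ^ (k + 1) * (1 + 2 * Real.exp (2 * R)) := by
  have h1 : ‖q ^ (2 * (k + 1))‖ ≤ ‖q‖ ^ (k + 1) := by
    rw [norm_pow]
    exact pow_le_pow_of_le_one (norm_nonneg _) hq.le (by omega)
  have h2 : ‖Complex.cos (2 * z)‖ ≤ Real.exp (2 * R) := by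
    refine (norm_cos_le _).trans (Real.exp_le_exp.mpr ?_)
    rw [norm_mul, Complex.norm_two]
    linarith
  refine (norm_sub_le _ _).trans ?_
  rw [norm_mul, norm_mul, norm_pow q (k + 1), Complex.norm_two]
  have h3 : 0 ≤ ‖q‖ ^ (k + 1) := by positivity
  nlinarith

lemma summable_norm_pow_succ {q : ℂ} (hq : ‖q‖ < 1) (C : ℝ) :
    Summable fun k : ℕ => ‖q‖ ^ (k + 1) * C :=
  (((summable_nat_add_iff 1).mpr (summable_geometric_of_lt_one (norm_nonneg _) hq))).mul_right C

lemma summable_thetaFactor_sub_one {q : ℂ} (hq : ‖q‖ < 1) (z : ℂ) :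
    Summable fun k : ℕ => ‖q ^ (2 * (k + 1)) - 2 * q ^ (k + 1) * Complex.cos (2 * z)‖ :=
  (summable_norm_pow_succ hq _).of_nonneg_of_le (fun _ => norm_nonneg _)
    fun k => norm_thetaFactor_sub_one_le hq le_rfl k

lemma multipliableLocallyUniformlyOn_thetaFactor {q : ℂ} (hq : ‖q‖ < 1) (R : ℝ) :
    MultipliableLocallyUniformlyOn (thetaFactor q) (Metric.ball 0 R) := by
  refine Summable.multipliableLocallyUniformlyOn_nat_one_add Metric.isOpen_ball
    (summable_norm_pow_succ hq (1 + 2 * Real.exp (2 * R)))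
    (Eventually.of_forall fun k z hz => norm_thetaFactor_sub_one_le hq (mem_ball_zero_iff.mp hz).le k)
    fun k => by fun_prop

lemma tendsto_qPoch {q : ℂ} (hq : ‖q‖ < 1) :
    ∃ c ≠ 0, Tendsto (qPoch q) atTop (𝓝 c) := by
  have hs : Summable fun k : ℕ => ‖-q ^ (k + 1)‖ := by
    simpa using summable_norm_pow_succ hq 1
  refine ⟨∏' k : ℕ, (1 + -q ^ (k + 1)), tprod_one_add_ne_zero_of_summable
    (fun k => by simpa [← sub_eq_add_neg] using one_sub_pow_succ_ne_zero hq k) hs, ?_⟩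
  have h := (multipliable_one_add_of_summable hs).hasProd.tendsto_prod_nat
  exact h.congr fun n => Finset.prod_congr rfl fun k _ => (sub_eq_add_neg _ _).symm

lemma summable_theta_bound {r : ℝ} (h0 : 0 < r) (h1 : r < 1) (C : ℝ) :
    Summable fun n : ℕ => r ^ (n * (n + 1) / 2) * Real.exp ((2 * n + 1) * C) := by
  refine summable_of_ratio_test_tendsto_lt_one zero_lt_one
    (Eventually.of_forall fun n => by positivity) ?_
  have h : Tendsto (fun n : ℕ => r ^ (n + 1) * Real.exp (2 * C)) atTop (𝓝 0) := by
    simpa using (((tendsto_pow_atTop_nhds_zero_of_lt_one h0.le h1).comp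
      (tendsto_add_atTop_nat 1)).mul_const (Real.exp (2 * C)))
  refine h.congr fun n => ?_
  rw [Real.norm_of_nonneg (by positivity), Real.norm_of_nonneg (by positivity), triangle_succ,
    show ((2 * ((n + 1 : ℕ) : ℝ) + 1) * C) = (2 * n + 1) * C + 2 * C by push_cast; ring,
    Real.exp_add, pow_add r _ (n + 1)]
  field_simp

/-- The Jacobi triple product identity, obtained from its finite form by dominated convergence. The
value of the nonzero constant does not matter for logarithmic derivatives. -/
theorem exists_theta1_eq_mul_tprod {τ : ℂ} (hτ : 0 < τ.im) :
    ∃ C ≠ 0, ∀ z, theta1 z τ = C * (Complex.sin z * ∏' k, thetaFactor (q τ) k z) := by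
  have hq := norm_q_lt_one hτ
  have hq0 : 0 < ‖q τ‖ := norm_pos_iff.mpr (q_ne_zero τ)
  obtain ⟨c, hc, hlim⟩ := tendsto_qPoch hq
  refine ⟨2 * cexp (2 * Real.pi * I * τ / 8) * c, by simp [hc, Complex.exp_ne_zero], fun z => ?_⟩
  obtain ⟨A, hA⟩ := hlim.norm.bddAbove_range
  obtain ⟨B, hB⟩ := (hlim.inv₀ hc).norm.bddAbove_range
  have hA' (n : ℕ) : ‖qPoch (q τ) n‖ ≤ A := hA ⟨n, rfl⟩
  have hB' (n : ℕ) : ‖(qPoch (q τ) n)⁻¹‖ ≤ B := hB ⟨n, rfl⟩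
  have hA0 : 0 ≤ A := (norm_nonneg _).trans (hA' 0)
  have hB0 : 0 ≤ B := (norm_nonneg _).trans (hB' 0)
  have hbd (m n : ℕ) : ‖thetaCoeff (q τ) m n‖ ≤ A * (B * B) := by
    rw [thetaCoeff]
    split_ifs
    · rw [div_eq_mul_inv, mul_inv, norm_mul, norm_mul]
      exact mul_le_mul (hA' _) (mul_le_mul (hB' _) (hB' _) (norm_nonneg _) hB0)
        (by positivity) hA0
    · simp only [norm_zero]; positivity
  have hco (n : ℕ) : Tendsto (fun m => thetaCoeff (q τ) m n) atTop (𝓝 c⁻¹) := by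
    have h1 : Tendsto (fun m => 2 * m + 1) atTop atTop :=
      tendsto_atTop_mono (fun m => by simp only [id]; omega) tendsto_id
    have h2 : Tendsto (fun m => m + n + 1) atTop atTop :=
      tendsto_atTop_mono (fun m => by simp only [id]; omega) tendsto_id
    have h := (hlim.comp h1).div ((hlim.comp (tendsto_sub_atTop_nat n)).mul (hlim.comp h2))
      (mul_ne_zero hc hc)
    rw [div_mul_cancel_left₀ hc] at h
    refine h.congr' ?_
    filter_upwards [eventually_ge_atTop n] with m hm
    simp [thetaCoeff, hm]
  have hT := tendsto_tsum_of_dominated_convergence (𝓕 := atTop)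
    (f := fun m n : ℕ => (-1) ^ n * q τ ^ (n * (n + 1) / 2) * thetaCoeff (q τ) m n *
      Complex.sin ((2 * n + 1) * z))
    (g := fun n : ℕ => (-1) ^ n * q τ ^ (n * (n + 1) / 2) * c⁻¹ * Complex.sin ((2 * n + 1) * z))
    ((summable_theta_bound hq0 hq ‖z‖).mul_left (A * (B * B)))
    (fun n => ((hco n).const_mul _).mul_const _)
    (Eventually.of_forall fun m n => by
      rw [norm_mul, norm_mul, norm_mul, norm_pow, norm_pow, norm_neg, norm_one, one_pow, one_mul]
      have h1 := hbd m n
      have h2 : ‖Complex.sin ((2 * n + 1) * z)‖ ≤ Real.exp ((2 * n + 1) * ‖z‖) := by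
        refine (norm_sin_le _).trans (Real.exp_le_exp.mpr ?_)
        rw [norm_mul]
        gcongr
        exact (norm_add_le _ _).trans (by simp)
      calc _ ≤ ‖q τ‖ ^ (n * (n + 1) / 2) * (A * (B * B)) * Real.exp ((2 * n + 1) * ‖z‖) := by
            gcongr
        _ = _ := by ring)
  have hP := (multipliable_one_add_of_summable
    (summable_thetaFactor_sub_one hq z)).hasProd.tendsto_prod_nat.const_mul (Complex.sin z)
  have heq (m : ℕ) : ∑' n : ℕ, (-1) ^ n * q τ ^ (n * (n + 1) / 2) * thetaCoeff (q τ) m n *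
      Complex.sin ((2 * n + 1) * z) = Complex.sin z * ∏ k ∈ Finset.range m,
        (1 + (q τ ^ (2 * (k + 1)) - 2 * q τ ^ (k + 1) * Complex.cos (2 * z))) := by
    rw [tsum_eq_sum (s := Finset.range (m + 1)), ← sin_mul_prod_eq_sum hq z m (m + 1) (by omega)]
    · congr 1
      exact Finset.prod_congr rfl fun k _ => by ring
    · intro n hn
      rw [thetaCoeff_of_lt _ (by simpa using hn)]
      ring
  have hlim2 := tendsto_nhds_unique (hT.congr heq) hP
  change _ = Complex.sin z * ∏' k, thetaFactor (q τ) k z at hlim2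
  rw [← hlim2, theta1, ← tsum_mul_left, ← tsum_mul_left]
  refine tsum_congr fun n => ?_
  field_simp

lemma thetaFactor_eq (τ z : ℂ) (k : ℕ) : thetaFactor (q τ) k z =
    (1 - q τ ^ (k + 1) * cexp (2 * I * z)) * (1 - q τ ^ (k + 1) * cexp (-(2 * I * z))) := by
  have h : cexp (2 * I * z) * cexp (-(2 * I * z)) = 1 := by rw [← Complex.exp_add]; simp
  rw [thetaFactor, Complex.cos, show 2 * z * I = 2 * I * z by ring,
    show -(2 * z) * I = -(2 * I * z) by ring]
  linear_combination (-(q τ) ^ (2 * (k + 1))) * h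

/-- `θ₁(·|τ)` vanishes only on the lattice `πℤ + πτℤ`. -/
lemma exists_of_theta1_eq_zero {τ z : ℂ} (hτ : 0 < τ.im) (h : theta1 z τ = 0) :
    ∃ a b : ℤ, z = Real.pi * a + Real.pi * τ * b := by
  have hq := norm_q_lt_one hτ
  obtain ⟨C, hC, hθ⟩ := exists_theta1_eq_mul_tprod hτ
  have h0 : Complex.sin z = 0 ∨ ∃ k, thetaFactor (q τ) k z = 0 := by
    by_contra! hne
    refine mul_ne_zero hC (mul_ne_zero hne.1 ?_) ((hθ z).symm.trans h)
    exact tprod_one_add_ne_zero_of_summable hne.2 (summable_thetaFactor_sub_one hq z)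
  rcases h0 with h0 | ⟨k, hk⟩
  · obtain ⟨a, rfl⟩ := Complex.sin_eq_zero_iff.mp h0
    exact ⟨a, 0, by push_cast; ring⟩
  · rw [thetaFactor_eq, mul_eq_zero, sub_eq_zero, sub_eq_zero, q, ← Complex.exp_nat_mul,
      ← Complex.exp_add, ← Complex.exp_add] at hk
    rcases hk with hk | hk <;> obtain ⟨n, hn⟩ := Complex.exp_eq_one_iff.mp hk.symm
    · refine ⟨n, -(k + 1), mul_left_cancel₀ (mul_ne_zero two_ne_zero I_ne_zero) ?_⟩
      push_cast at hn ⊢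
      linear_combination hn
    · refine ⟨-n, k + 1, mul_left_cancel₀ (mul_ne_zero two_ne_zero I_ne_zero) ?_⟩
      push_cast at hn ⊢
      linear_combination -hn

lemma differentiable_thetaFactor (q : ℂ) (k : ℕ) : Differentiable ℂ (thetaFactor q k) := by
  unfold thetaFactor
  fun_prop

lemma differentiable_theta1 {τ : ℂ} (hτ : 0 < τ.im) : Differentiable ℂ fun z => theta1 z τ := by
  have hq := norm_q_lt_one hτ
  obtain ⟨C, _, hθ⟩ := exists_theta1_eq_mul_tprod hτ
  intro z
  have h := ((multipliableLocallyUniformlyOn_thetaFactor hq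
    (‖z‖ + 1)).hasProdLocallyUniformlyOn).differentiableOn
    (Eventually.of_forall fun s =>
      (by have := differentiable_thetaFactor (q τ); fun_prop)) Metric.isOpen_ball
  have h2 := h.differentiableAt (Metric.isOpen_ball.mem_nhds (x := z) (by simp))
  simp only [hθ]
  exact ((Complex.differentiable_sin z).mul h2).const_mul C

lemma theta1LogDeriv_differentiableAt {τ z : ℂ} (hτ : 0 < τ.im) (hz : theta1 z τ ≠ 0) :
    DifferentiableAt ℂ (fun w => theta1LogDeriv w τ) z := by
  have h := differentiable_theta1 hτ
  exact ((h.contDiff (n := 2)).differentiable_deriv_two z).div (h z) hz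

/-- The function `y / (1 - y) = ∑_{n ≥ 1} y^n`. -/
def geomTail (y : ℂ) : ℂ := y / (1 - y)

lemma summable_geomTail {q : ℂ} (hq : ‖q‖ < 1) (x : ℂ) :
    Summable fun k : ℕ => geomTail (q ^ k * x) := by
  refine Summable.of_norm_bounded_eventually_nat (g := fun k => ‖q‖ ^ k * (‖x‖ * 2))
    ((summable_geometric_of_lt_one (norm_nonneg _) hq).mul_right _) ?_
  have h : Tendsto (fun k => ‖q‖ ^ k * ‖x‖) atTop (𝓝 0) := by
    simpa using (tendsto_pow_atTop_nhds_zero_of_lt_one (norm_nonneg _) hq).mul_const ‖x‖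
  filter_upwards [h.eventually_lt_const (show (0 : ℝ) < 1 / 2 by norm_num)] with k hk
  have h1 := norm_sub_norm_le 1 (q ^ k * x)
  rw [norm_one, norm_mul, norm_pow] at h1
  rw [geomTail, norm_div, norm_mul, norm_pow, div_le_iff₀ (by linarith)]
  have h2 : 0 ≤ ‖q‖ ^ k * ‖x‖ := by positivity
  nlinarith

lemma logDeriv_thetaFactor {τ z : ℂ} {k : ℕ} (h : thetaFactor (q τ) k z ≠ 0) :
    logDeriv (thetaFactor (q τ) k) z =
      -2 * I * geomTail (q τ ^ (k + 1) * cexp (2 * I * z)) +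
        2 * I * geomTail (q τ ^ (k + 1) * cexp (-(2 * I * z))) := by
  have hd : HasDerivAt (thetaFactor (q τ) k) (4 * q τ ^ (k + 1) * Complex.sin (2 * z)) z := by
    have h1 : HasDerivAt (fun w : ℂ => 2 * w) 2 z := by simpa using (hasDerivAt_id z).const_mul 2
    have h2 := ((h1.ccos.const_mul (2 * q τ ^ (k + 1))).const_sub (q τ ^ (2 * (k + 1)))).const_add 1
    convert! h2 using 1
    ring
  rw [logDeriv_apply, hd.deriv]
  rw [thetaFactor_eq] at h ⊢
  have h1 := left_ne_zero_of_mul h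
  have h2 := right_ne_zero_of_mul h
  rw [Complex.sin, show 2 * z * I = 2 * I * z by ring,
    show -(2 * z) * I = -(2 * I * z) by ring, geomTail, geomTail]
  field_simp
  ring

/-- The logarithmic derivative of `θ₁`, obtained by differentiating the product termwise. -/
lemma theta1LogDeriv_eq {τ z : ℂ} (hτ : 0 < τ.im) (hz : theta1 z τ ≠ 0) :
    theta1LogDeriv z τ = -I - 2 * I * ∑' j : ℕ, geomTail (q τ ^ j * cexp (2 * I * z)) +
      2 * I * ∑' j : ℕ, geomTail (q τ ^ (j + 1) * cexp (-(2 * I * z))) := by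
  have hq := norm_q_lt_one hτ
  obtain ⟨C, hC, hθ⟩ := exists_theta1_eq_mul_tprod hτ
  have hne := hz
  rw [hθ] at hne
  have hsin := left_ne_zero_of_mul (right_ne_zero_of_mul hne)
  have hprod := right_ne_zero_of_mul (right_ne_zero_of_mul hne)
  have hfac (k : ℕ) : thetaFactor (q τ) k z ≠ 0 := by
    intro h0
    refine hprod (tprod_of_exists_eq_zero ⟨k, h0⟩)
  have hs1 := summable_geomTail hq (cexp (2 * I * z))
  have hs1' := (summable_nat_add_iff 1).mpr hs1
  have hs2 := (summable_nat_add_iff 1).mpr (summable_geomTail hq (cexp (-(2 * I * z))))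
  have hsum : Summable fun k => logDeriv (thetaFactor (q τ) k) z := by
    simp only [logDeriv_thetaFactor (hfac _)]
    exact (hs1'.mul_left _).add (hs2.mul_left _)
  have hP := multipliableLocallyUniformlyOn_thetaFactor hq (‖z‖ + 1)
  have hzb : z ∈ Metric.ball (0 : ℂ) (‖z‖ + 1) := by simp
  have hlog := logDeriv_tprod_eq_tsum Metric.isOpen_ball hzb hfac
    (fun k => (differentiable_thetaFactor _ k).differentiableOn) hsum hP hprod
  have hdP : DifferentiableAt ℂ (fun w => ∏' k, thetaFactor (q τ) k w) z :=
    (hP.hasProdLocallyUniformlyOn.differentiableOn (Eventually.of_forall fun s =>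
      (by have := differentiable_thetaFactor (q τ); fun_prop))
      Metric.isOpen_ball).differentiableAt (Metric.isOpen_ball.mem_nhds hzb)
  have h1x : 1 - cexp (2 * I * z) ≠ 0 := by
    intro h0
    apply hsin
    have hx : cexp (z * I) * cexp (z * I) = 1 := by
      rw [← Complex.exp_add, show z * I + z * I = 2 * I * z by ring]
      linear_combination -h0
    have hx2 : cexp (-z * I) * cexp (z * I) = 1 := by rw [← Complex.exp_add]; simp
    rw [Complex.sin, mul_right_cancel₀ (Complex.exp_ne_zero _) (hx2.trans hx.symm)]
    simp
  have hcot : Complex.cot z = -I - 2 * I * geomTail (cexp (2 * I * z)) := by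
    rw [Complex.cot_eq_exp_ratio, geomTail]
    have := I_sq
    field_simp
    linear_combination (1 + cexp (2 * I * z)) * this
  rw [theta1LogDeriv]
  simp only [hθ]
  rw [logDeriv_const_mul _ _ hC, logDeriv_mul z hsin hprod (Complex.differentiable_sin z) hdP,
    hlog, Complex.logDeriv_sin, hcot]
  simp only [logDeriv_thetaFactor (hfac _)]
  rw [(hs1'.mul_left _).tsum_add (hs2.mul_left _), tsum_mul_left, tsum_mul_left,
    hs1.tsum_eq_zero_add]
  simp only [pow_zero, one_mul]
  ring

/-! ### Partial fractions of the cotangent and the Lipschitz formula -/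

/-- The sum `∑_{n ∈ ℤ} (z + n)^{-s}`. -/
def intSum (s : ℕ) (z : ℂ) : ℂ := ∑' n : ℤ, 1 / (z + n) ^ s

lemma summable_intSum {s : ℕ} (hs : 2 ≤ s) (z : ℂ) :
    Summable fun n : ℤ => 1 / (z + n) ^ s := by
  have h := EisensteinSeries.linear_right_summable z 1 (k := s) (by exact_mod_cast hs)
  simpa using h

lemma intSum_add_int (s : ℕ) (z : ℂ) (m : ℤ) : intSum s (z + m) = intSum s z := by
  rw [intSum, intSum, ← (Equiv.addLeft m).tsum_eq fun n : ℤ => 1 / (z + n) ^ s]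
  refine tsum_congr fun n => ?_
  simp [add_assoc]

lemma intSum_neg {s : ℕ} (hs : Even s) (z : ℂ) : intSum s (-z) = intSum s z := by
  rw [intSum, intSum, ← (Equiv.neg ℤ).tsum_eq fun n : ℤ => 1 / (z + n) ^ s]
  refine tsum_congr fun n => ?_
  rw [← hs.neg_pow (-z + n)]
  simp [add_comm]

lemma contDiffAt_cot {x : ℂ} (hx : Complex.sin x ≠ 0) (n : WithTop ℕ∞) :
    ContDiffAt ℂ n Complex.cot x := by
  have : Complex.cot = fun z => Complex.cos z / Complex.sin z := rfl
  rw [this]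
  exact Complex.contDiff_cos.contDiffAt.div Complex.contDiff_sin.contDiffAt hx

/-- The partial fractions of the derivatives of the cotangent, in the upper half plane. -/
lemma iteratedDeriv_cot_of_im_pos {k : ℕ} (hk : 1 ≤ k) {w : ℂ} (hw : 0 < w.im) :
    iteratedDeriv k Complex.cot w =
      (-1) ^ k * k.factorial / (Real.pi : ℂ) ^ (k + 1) * intSum (k + 1) (w / Real.pi) := by
  have hpi : (Real.pi : ℂ) ≠ 0 := by exact_mod_cast Real.pi_ne_zero
  have hc : (fun z => ((Real.pi : ℂ)⁻¹ * (Real.pi * Complex.cot (Real.pi * ((Real.pi : ℂ)⁻¹ * z))))) =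
      Complex.cot := by
    funext z
    rw [mul_inv_cancel_left₀ hpi, inv_mul_cancel_left₀ hpi]
  have him (v : ℂ) (hv : 0 < v.im) : 0 < ((Real.pi : ℂ)⁻¹ * v).im := by
    rw [← Complex.ofReal_inv, Complex.im_ofReal_mul]
    exact mul_pos (inv_pos.mpr Real.pi_pos) hv
  have hopen := UpperHalfPlane.isOpen_upperHalfPlaneSet
  have hud := hopen.uniqueDiffOn (𝕜 := ℂ)
  have hF : ContDiffOn ℂ k (fun z : ℂ => (Real.pi : ℂ) * Complex.cot (Real.pi * z))
      UpperHalfPlane.upperHalfPlaneSet := by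
    intro z hz
    exact contDiffWithinAt_const.mul (cot_pi_mul_contDiffWithinAt k
      (UpperHalfPlane.coe_mem_integerComplement ⟨z, hz⟩))
  have h := iteratedDerivWithin_comp_const_smul (show w ∈ UpperHalfPlane.upperHalfPlaneSet from hw)
    hud hF (Real.pi : ℂ)⁻¹ (fun z hz => him z hz)
  rw [← hc, ← iteratedDerivWithin_of_isOpen hopen (show w ∈ UpperHalfPlane.upperHalfPlaneSet from hw),
    iteratedDerivWithin_const_mul_field, h,
    iteratedDerivWithin_cot_pi_mul_eq_mul_tsum_div_pow hk (him w hw), intSum, smul_eq_mul,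
    div_eq_inv_mul w]
  rw [inv_pow]
  field_simp
  ring

lemma tendsto_intSum {s : ℕ} (hs : 2 ≤ s) (x : ℝ) (hx : ∀ n : ℤ, (x : ℂ) + n ≠ 0) :
    Tendsto (fun y : ℝ => intSum s (x + y * I)) (𝓝[>] 0) (𝓝 (intSum s x)) := by
  refine tendsto_tsum_of_dominated_convergence (bound := fun n : ℤ => ‖1 / ((x : ℂ) + n) ^ s‖)
    (summable_intSum hs x).norm (fun n => ?_) (Eventually.of_forall fun y n => ?_)
  · have hc : ContinuousAt (fun y : ℝ => 1 / ((x : ℂ) + y * I + n) ^ s) 0 := by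
      refine ContinuousAt.div (by fun_prop) (by fun_prop) (pow_ne_zero _ ?_)
      simpa using hx n
    have h := hc.tendsto.mono_left (nhdsWithin_le_nhds (s := Set.Ioi 0))
    simpa using h
  · rw [norm_div, norm_div, norm_pow, norm_pow]
    have h1 : ‖(x : ℂ) + n‖ ≤ ‖(x : ℂ) + y * I + n‖ := by
      have h2 := Complex.abs_re_le_norm ((x : ℂ) + y * I + n)
      have h3 : ‖(x : ℂ) + n‖ = |x + n| := by
        rw [← Real.norm_eq_abs, ← Complex.norm_real]; push_cast; rfl
      rw [h3]
      simpa using h2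
    have h4 : 0 < ‖(x : ℂ) + n‖ := norm_pos_iff.mpr (hx n)
    gcongr

/-- The formula `iteratedDeriv_cot_of_im_pos` persists at real points that are not poles, by
approaching them from the upper half plane. -/
lemma iteratedDeriv_cot_real {k : ℕ} (hk : 1 ≤ k) (x : ℝ) (hx : ∀ n : ℤ, (x : ℂ) + n ≠ 0) :
    iteratedDeriv k Complex.cot (Real.pi * x) =
      (-1) ^ k * k.factorial / (Real.pi : ℂ) ^ (k + 1) * intSum (k + 1) x := by
  have hpi : (Real.pi : ℂ) ≠ 0 := by exact_mod_cast Real.pi_ne_zero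
  have hsin : Complex.sin (Real.pi * x) ≠ 0 := by
    intro h0
    obtain ⟨n, hn⟩ := Complex.sin_eq_zero_iff.mp h0
    apply hx (-n)
    apply mul_left_cancel₀ hpi
    push_cast
    linear_combination hn
  have hcont : ContinuousAt (iteratedDeriv k Complex.cot) (Real.pi * x) := by
    have hA : AnalyticAt ℂ Complex.cot (Real.pi * x) :=
      (contDiffAt_cot hsin ⊤).analyticAt
    rw [iteratedDeriv_eq_iterate]
    exact (hA.iterated_deriv k).continuousAt
  have hpath : Tendsto (fun y : ℝ => (Real.pi : ℂ) * (x + y * I)) (𝓝[>] 0) (𝓝 (Real.pi * x)) := by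
    have h : ContinuousAt (fun y : ℝ => (Real.pi : ℂ) * (x + y * I)) 0 := by fun_prop
    simpa using h.tendsto.mono_left (nhdsWithin_le_nhds (s := Set.Ioi 0))
  refine tendsto_nhds_unique (hcont.tendsto.comp hpath)
    (((tendsto_intSum (by omega) x hx).const_mul _).congr' ?_)
  filter_upwards [self_mem_nhdsWithin] with y hy
  have hy' : 0 < ((Real.pi : ℂ) * (x + y * I)).im := by
    rw [Complex.im_ofReal_mul]
    simpa using mul_pos Real.pi_pos hy
  rw [Function.comp_apply, iteratedDeriv_cot_of_im_pos hk hy', mul_div_cancel_left₀ _ hpi]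

/-- The Lipschitz formula for even exponents. -/
lemma intSum_eq_tsum_pnat (k : ℕ) {z : ℂ} (hz : 0 < z.im) : intSum (2 * k + 2) z =
    (-1) ^ (k + 1) * (2 * Real.pi) ^ (2 * k + 2) / ((2 * k + 1).factorial : ℂ) *
      ∑' n : ℕ+, ((n : ℕ) : ℂ) ^ (2 * k + 1) * cexp (2 * Real.pi * I * z) ^ (n : ℕ) := by
  have h := EisensteinSeries.qExpansion_identity_pnat (k := 2 * k + 1) (by omega) ⟨z, hz⟩
  have hI : (-2 * Real.pi * I : ℂ) ^ (2 * k + 2) = (-1) ^ (k + 1) * (2 * Real.pi) ^ (2 * k + 2) := by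
    rw [show 2 * k + 2 = 2 * (k + 1) by ring, pow_mul, pow_mul, ← mul_pow]
    congr 1
    linear_combination (4 * (Real.pi : ℂ) ^ 2) * I_sq
  rw [← hI]
  exact h

lemma pow_mul_le_pow_natPred_mul {r : ℝ} (h0 : 0 ≤ r) (h1 : r ≤ 1) (m n : ℕ+) :
    r ^ ((m : ℕ) * (n : ℕ)) ≤ r ^ m.natPred * r ^ (n : ℕ) := by
  rw [← pow_add]
  refine pow_le_pow_of_le_one h0 h1 ?_
  have h2 := m.natPred_add_one
  have h3 := n.pos
  rw [← h2]
  nlinarith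

/-- The double series over `m, n ≥ 1` of `n^K q^{mn}` with bounded coefficients converges
absolutely. -/
lemma summable_pow_mul_bounded {q : ℂ} (hq : ‖q‖ < 1) (K : ℕ) (c : ℕ+ × ℕ+ → ℂ) {C : ℝ}
    (hc : ∀ p, ‖c p‖ ≤ C) : Summable fun p : ℕ+ × ℕ+ =>
      ((p.2 : ℕ) : ℂ) ^ K * c p * q ^ ((p.1 : ℕ) * (p.2 : ℕ)) := by
  have h1 : Summable fun m : ℕ+ => ‖q‖ ^ m.natPred :=
    (summable_geometric_of_lt_one (norm_nonneg _) hq).comp_injective PNat.natPred_injective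
  have h2 : Summable fun n : ℕ+ => ((n : ℕ) : ℝ) ^ K * ‖q‖ ^ (n : ℕ) :=
    (summable_pow_mul_geometric_of_norm_lt_one K (r := ‖q‖) (by simpa using hq)).comp_injective
      PNat.coe_injective
  refine Summable.of_norm_bounded ((h1.mul_of_nonneg h2 (fun _ => by simp only [Pi.zero_apply]; positivity)
    (fun _ => by simp only [Pi.zero_apply]; positivity)).mul_left C) fun p => ?_
  have h3 := pow_mul_le_pow_natPred_mul (norm_nonneg q) hq.le p.1 p.2
  rw [norm_mul, norm_mul, norm_pow, norm_pow, Complex.norm_natCast]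
  have hC := (norm_nonneg _).trans (hc p)
  calc _ ≤ ((p.2 : ℕ) : ℝ) ^ K * C * (‖q‖ ^ p.1.natPred * ‖q‖ ^ (p.2 : ℕ)) := by
        gcongr
        exact hc p
    _ = _ := by ring

/-! ### Character sums and the two orders of summation -/

lemma char_natCast_zero {N : ℕ} (hN : 2 ≤ N) (χ : DirichletCharacter ℂ N) :
    χ ((0 : ℕ) : ZMod N) = 0 := by
  have : Fact (1 < N) := ⟨hN⟩
  rw [Nat.cast_zero]
  exact χ.map_nonunit not_isUnit_zero

lemma char_neg {N : ℕ} {χ : DirichletCharacter ℂ N} (hχ : χ.Even) (a : ZMod N) :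
    χ (-a) = χ a := by
  rw [← neg_one_mul, map_mul, hχ, one_mul]

lemma char_natCast_sub {N : ℕ} {χ : DirichletCharacter ℂ N} (hχ : χ.Even) {k : ℕ} (hk : k ≤ N) :
    χ ((N - k : ℕ) : ZMod N) = χ (k : ZMod N) := by
  rw [Nat.cast_sub hk, ZMod.natCast_self, zero_sub, char_neg hχ]

/-- Reflection `k ↦ N - k` in a sum weighted by an even character. -/
lemma sum_char_mul_reflect {N : ℕ} {χ : DirichletCharacter ℂ N} (hχ : χ.Even) (F : ℕ → ℂ) :
    ∑ k ∈ Finset.Icc 1 (N - 1), χ (k : ZMod N) * F (N - k) =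
      ∑ k ∈ Finset.Icc 1 (N - 1), χ (k : ZMod N) * F k := by
  refine Finset.sum_nbij' (fun k => N - k) (fun k => N - k) ?_ ?_ ?_ ?_ ?_ <;>
    intro k hk <;> rw [Finset.mem_Icc] at hk
  · rw [Finset.mem_Icc]; omega
  · rw [Finset.mem_Icc]; omega
  · omega
  · omega
  · rw [char_natCast_sub hχ (by omega)]

lemma sum_range_char_mul {N : ℕ} (hN : 2 ≤ N) (χ : DirichletCharacter ℂ N) (F : ℕ → ℂ) :
    ∑ k ∈ Finset.range N, χ (k : ZMod N) * F k =
      ∑ k ∈ Finset.Icc 1 (N - 1), χ (k : ZMod N) * F k := by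
  have h : Finset.range N = insert 0 (Finset.Icc 1 (N - 1)) := by
    ext k; simp only [Finset.mem_range, Finset.mem_insert, Finset.mem_Icc]; omega
  rw [h, Finset.sum_insert (by simp), char_natCast_zero hN, zero_mul, zero_add]

lemma sum_zmod_char_mul {N : ℕ} (hN : 2 ≤ N) (χ : DirichletCharacter ℂ N) [NeZero N]
    (F : ℕ → ℂ) :
    ∑ a : ZMod N, χ a * F a.val = ∑ k ∈ Finset.Icc 1 (N - 1), χ (k : ZMod N) * F k := by
  have h1 : ∑ a : ZMod N, χ a * F a.val = ∑ k ∈ Finset.range N, χ (k : ZMod N) * F k := by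
    refine Finset.sum_nbij' (fun a => a.val) (fun k => (k : ZMod N)) ?_ ?_ ?_ ?_ ?_
    · intro a _; simpa using ZMod.val_lt a
    · intro k _; simp
    · intro a _; simp
    · intro k hk; exact ZMod.val_cast_of_lt (by simpa using hk)
    · intro a _; simp
  rw [h1, sum_range_char_mul hN]

lemma sum_char_eq_zero {N : ℕ} (hN : 2 ≤ N) {χ : DirichletCharacter ℂ N} (hχ : χ ≠ 1) :
    ∑ k ∈ Finset.Icc 1 (N - 1), χ (k : ZMod N) = 0 := by
  have : NeZero N := ⟨by omega⟩
  have h := sum_zmod_char_mul hN χ fun _ => 1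
  simp only [mul_one] at h
  rw [← h]
  exact MulChar.sum_eq_zero_of_ne_one hχ

/-- A sum over `ℕ` weighted by a character, computed residue class by residue class. -/
lemma sum_char_mul_tsum {N : ℕ} (hN : 2 ≤ N) (χ : DirichletCharacter ℂ N) (f : ℕ → ℂ)
    (hf : Summable fun M : ℕ => χ (M : ZMod N) * f M) :
    ∑ k ∈ Finset.Icc 1 (N - 1), χ (k : ZMod N) * ∑' j : ℕ, f (k + N * j) =
      ∑' M : ℕ, χ (M : ZMod N) * f M := by
  have : NeZero N := ⟨by omega⟩
  rw [Nat.sumByResidueClasses hf N, ← sum_zmod_char_mul hN χ fun k => ∑' j : ℕ, f (k + N * j)]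
  refine Finset.sum_congr rfl fun a _ => ?_
  rw [← tsum_mul_left]
  refine tsum_congr fun m => ?_
  simp

lemma tsum_char_mul_eq_tsum_pnat {N : ℕ} (hN : 2 ≤ N) (χ : DirichletCharacter ℂ N) (f : ℕ → ℂ)
    (hf : Summable fun M : ℕ => χ (M : ZMod N) * f M) :
    ∑' M : ℕ, χ (M : ZMod N) * f M = ∑' M : ℕ+, χ ((M : ℕ) : ZMod N) * f M := by
  rw [← tsum_zero_pnat_eq_tsum_nat hf, char_natCast_zero hN, zero_mul, zero_add]

/-- The contribution of one cell of the lattice `ℤ + ℤτ` to the sum of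
`χ(m) (m/N + nτ)^{-s}` over all `m, n`: the terms with `m = r + N p.1`, `0 < r < N`, and
`n = p.2`. -/
def cellSum {N : ℕ} (χ : DirichletCharacter ℂ N) (τ : ℂ) (s : ℕ) (p : ℤ × ℤ) : ℂ :=
  ∑ r ∈ Finset.Icc 1 (N - 1), χ (r : ZMod N) * (1 / ((r : ℂ) / N + p.1 + p.2 * τ) ^ s)

lemma natCast_div_add_int_ne_zero {N r : ℕ} (hr : r ∈ Finset.Icc 1 (N - 1)) (n : ℤ) :
    ((((r : ℝ) / N : ℝ)) : ℂ) + n ≠ 0 := by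
  rw [Finset.mem_Icc] at hr
  have hN : (N : ℂ) ≠ 0 := by
    rw [Nat.cast_ne_zero]; omega
  intro h
  push_cast at h
  field_simp at h
  rw [mul_zero] at h
  have h' : (r : ℤ) + n * N = 0 := by
    have : (((r : ℤ) + N * n : ℤ) : ℂ) = 0 := by push_cast; exact h
    rw [mul_comm]; exact_mod_cast this
  have h1 : (N : ℤ) ∣ r := ⟨-n, by linarith⟩
  have h2 := Nat.le_of_dvd (by omega) (Int.natCast_dvd_natCast.mp h1)
  omega

/-- The odd coefficients `B_{2k+1}(χ)`, from the partial fractions of the cotangent. -/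
lemma B_odd {N : ℕ} (χ : DirichletCharacter ℂ N) (k : ℕ) :
    -B χ (2 * k + 1) * (Real.pi : ℂ) ^ (2 * k + 2) =
      ∑ r ∈ Finset.Icc 1 (N - 1), χ (r : ZMod N) * intSum (2 * k + 2) ((r : ℂ) / N) := by
  have hpi : (Real.pi : ℂ) ≠ 0 := by exact_mod_cast Real.pi_ne_zero
  have hsin (r : ℕ) (hr : r ∈ Finset.Icc 1 (N - 1)) :
      Complex.sin (0 + r * Real.pi / N) ≠ 0 := by
    intro h0
    obtain ⟨n, hn⟩ := Complex.sin_eq_zero_iff.mp h0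
    apply natCast_div_add_int_ne_zero hr (-n)
    apply mul_left_cancel₀ hpi
    push_cast
    linear_combination hn
  have hcd (r : ℕ) (hr : r ∈ Finset.Icc 1 (N - 1)) : ContDiffAt ℂ ((2 * k + 1 : ℕ) : WithTop ℕ∞)
      (fun z : ℂ => Complex.cot (z + r * Real.pi / N)) 0 :=
    ContDiffAt.comp (g := Complex.cot) (0 : ℂ) (contDiffAt_cot (hsin r hr) _) (by fun_prop)
  rw [B, iteratedDeriv_fun_sum fun r hr => contDiffAt_const.mul (hcd r hr), ← neg_div,
    div_mul_eq_mul_div, div_eq_iff (by exact_mod_cast Nat.factorial_ne_zero _), ← Finset.sum_neg_distrib,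
    Finset.sum_mul, Finset.sum_mul]
  refine Finset.sum_congr rfl fun r hr => ?_
  rw [iteratedDeriv_const_mul _ (hcd r hr), iteratedDeriv_comp_add_const]
  have h := iteratedDeriv_cot_real (k := 2 * k + 1) (by omega) ((r : ℝ) / N)
    (natCast_div_add_int_ne_zero hr)
  push_cast at h
  simp only
  rw [show 0 + (r : ℂ) * Real.pi / N = Real.pi * (r / N) by ring, h, Odd.neg_one_pow ⟨k, rfl⟩]
  field_simp

lemma norm_gaussSum_le {N : ℕ} (χ : DirichletCharacter ℂ N) (n : ℕ) : ‖gaussSum χ n‖ ≤ N := by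
  refine (norm_sum_le _ _).trans ((Finset.sum_le_card_nsmul _ _ 1 fun k _ => ?_).trans ?_)
  · have h : ‖cexp (2 * I * Real.pi * n * k / N)‖ = 1 := by
      rw [show 2 * I * Real.pi * n * k / N = ((2 * Real.pi * n * k / N : ℝ) : ℂ) * I by
        push_cast; ring]
      exact Complex.norm_exp_ofReal_mul_I _
    rw [norm_mul, h, mul_one]
    exact χ.norm_le_one _
  · rw [Nat.card_Icc, nsmul_eq_mul, mul_one]
    exact_mod_cast (by omega)

lemma summable_pow_mul_cexp_pow {z : ℂ} (hz : 0 < z.im) (K : ℕ) :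
    Summable fun n : ℕ+ => ((n : ℕ) : ℂ) ^ K * cexp (2 * Real.pi * I * z) ^ (n : ℕ) :=
  (summable_pow_mul_geometric_of_norm_lt_one K (norm_q_lt_one hz)).comp_injective
    PNat.coe_injective

/-- Summing the cells row by row gives the `q`-series `F_{2k+2}(τ, χ)`. -/
theorem eq_eisF_of_hasSum {N : ℕ} (hN : 2 ≤ N) {χ : DirichletCharacter ℂ N} (hχ : χ.Even)
    (τ : UpperHalfPlane) (k : ℕ) {V : ℂ} (hV : HasSum (cellSum χ τ (2 * k + 2)) V) :
    V = (Real.pi : ℂ) ^ (2 * k + 2) * eisF χ τ k := by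
  have hN0 : (N : ℂ) ≠ 0 := by rw [Nat.cast_ne_zero]; omega
  have hs : 2 ≤ 2 * k + 2 := by omega
  set R : ℤ → ℂ := fun n => ∑ r ∈ Finset.Icc 1 (N - 1),
    χ (r : ZMod N) * intSum (2 * k + 2) ((r : ℂ) / N + n * τ) with hR
  have hrow (n : ℤ) : HasSum (fun j : ℤ => cellSum χ τ (2 * k + 2) (j, n)) (R n) := by
    refine hasSum_sum fun r _ => HasSum.mul_left _ ?_
    have h := (summable_intSum hs ((r : ℂ) / N + n * τ)).hasSum
    convert! h using 4 with j
    simp only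
    ring
  have hRV : HasSum R V :=
    ((Equiv.prodComm ℤ ℤ).hasSum_iff.mpr hV).prod_fiberwise hrow
  -- The row of index `-n` becomes the row of index `n` under `r ↦ N - r`, as `χ` is even.
  have heven : Function.Even R := by
    intro n
    simp only [hR]
    rw [← sum_char_mul_reflect hχ fun r : ℕ => intSum (2 * k + 2) ((r : ℂ) / N + n * τ)]
    refine Finset.sum_congr rfl fun r hr => ?_
    rw [Finset.mem_Icc] at hr
    rw [← intSum_neg ⟨k + 1, by ring⟩, ← intSum_add_int _ _ 1, Nat.cast_sub (by omega)]
    congr 2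
    push_cast
    field_simp
    ring
  have hR0 : R 0 = -B χ (2 * k + 1) * (Real.pi : ℂ) ^ (2 * k + 2) := by
    rw [B_odd]
    simp [hR]
  have hRpos (m : ℕ+) : R ((m : ℕ) : ℤ) =
      (-1) ^ (k + 1) * (2 * Real.pi) ^ (2 * k + 2) / ((2 * k + 1).factorial : ℂ) *
      ∑' n : ℕ+, ((n : ℕ) : ℂ) ^ (2 * k + 1) * gaussSum χ n * q τ ^ ((m : ℕ) * (n : ℕ)) := by
    have him (r : ℕ) : 0 < ((r : ℂ) / N + ((m : ℕ) : ℤ) * τ).im := by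
      have h1 : ((r : ℂ) / N).im = 0 := by
        rw [show (r : ℂ) / N = ((r / N : ℝ) : ℂ) by push_cast; rfl, Complex.ofReal_im]
      rw [Complex.add_im, h1, zero_add, Int.cast_natCast, ← Complex.ofReal_natCast,
        Complex.im_ofReal_mul]
      exact mul_pos (by exact_mod_cast m.pos) τ.im_pos
    simp only [hR, intSum_eq_tsum_pnat k (him _)]
    rw [Finset.sum_congr rfl fun r _ => mul_left_comm _ _ _, ← Finset.mul_sum]
    congr 1
    rw [Finset.sum_congr rfl fun r _ => (tsum_mul_left).symm, ← Summable.tsum_finsetSum fun r _ =>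
      (summable_pow_mul_cexp_pow (him r) _).mul_left _]
    refine tsum_congr fun n => ?_
    rw [gaussSum, Finset.mul_sum, Finset.sum_mul]
    refine Finset.sum_congr rfl fun r _ => ?_
    have he : cexp (2 * Real.pi * I * ((r : ℂ) / N + ((m : ℕ) : ℤ) * τ)) ^ (n : ℕ) =
        cexp (2 * I * Real.pi * (n : ℕ) * r / N) * q τ ^ ((m : ℕ) * (n : ℕ)) := by
      rw [q, ← Complex.exp_nat_mul, ← Complex.exp_nat_mul, ← Complex.exp_add]
      congr 1
      push_cast
      ring
    rw [he]
    ring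
  have hsum := summable_pow_mul_bounded (norm_q_lt_one τ.im_pos) (2 * k + 1)
    (fun p => gaussSum χ p.2) (fun p => norm_gaussSum_le χ p.2)
  rw [← hRV.tsum_eq, tsum_int_eq_zero_add_two_mul_tsum_pnat heven hRV.summable, hR0]
  simp only [hRpos]
  rw [eisF, tsum_mul_left, hsum.tsum_prod, nsmul_eq_mul]
  push_cast
  ring

lemma im_neg_one_div_mul_pos {N : ℕ} (hN : 2 ≤ N) (τ : UpperHalfPlane) :
    0 < (-1 / (N * (τ : ℂ))).im := by
  have h : -1 / (N * (τ : ℂ)) = ((1 / N : ℝ) : ℂ) * (-(τ : ℂ))⁻¹ := by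
    push_cast; field_simp
  rw [h, Complex.im_ofReal_mul]
  exact mul_pos (by positivity) τ.im_inv_neg_coe_pos

/-- Summing the cells column by column gives `E_{2k+2}` at `-1/(Nτ)`. -/
theorem eq_eisE_of_hasSum {N : ℕ} (hN : 2 ≤ N) {χ : DirichletCharacter ℂ N} (hχ : χ.Even)
    (τ : UpperHalfPlane) (k : ℕ) {V : ℂ} (hV : HasSum (cellSum χ τ (2 * k + 2)) V) :
    V = (Real.pi : ℂ) ^ (2 * k + 2) *
      (1 / (τ : ℂ) ^ (2 * k + 2) * eisE χ (-1 / (N * (τ : ℂ))) k) := by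
  have hN0 : (N : ℂ) ≠ 0 := by rw [Nat.cast_ne_zero]; omega
  have hτ0 : (τ : ℂ) ≠ 0 := UpperHalfPlane.ne_zero τ
  have hs : 2 ≤ 2 * k + 2 := by omega
  set T : ℂ := -1 / (N * (τ : ℂ)) with hT
  have hTim : 0 < T.im := im_neg_one_div_mul_pos hN τ
  set c : ℤ → ℂ := fun m => intSum (2 * k + 2) (m * T) with hc
  have hcneg (m : ℤ) : c (-m) = c m := by
    simp only [hc]
    rw [← intSum_neg ⟨k + 1, by ring⟩]
    congr 1
    push_cast; ring
  set Y : ℤ → ℂ := fun j => ∑ r ∈ Finset.Icc 1 (N - 1), χ (r : ZMod N) * c (r + N * j) with hY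
  have hcol (j : ℤ) : HasSum (fun n : ℤ => cellSum χ τ (2 * k + 2) (j, n))
      (1 / (τ : ℂ) ^ (2 * k + 2) * Y j) := by
    simp only [hY, Finset.mul_sum]
    refine hasSum_sum fun r _ => ?_
    rw [mul_left_comm]
    refine HasSum.mul_left _ ?_
    rw [← hcneg]
    convert! (summable_intSum hs (((-(r + N * j) : ℤ) : ℂ) * T)).hasSum.mul_left
      (1 / (τ : ℂ) ^ (2 * k + 2)) using 2 with n
    rw [one_div_mul_one_div, ← mul_pow]
    simp only [hT]
    congr 2
    push_cast
    field_simp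
  have hYV := hV.prod_fiberwise hcol
  have hcpos (m : ℕ+) : c ((m : ℕ) : ℤ) =
      (-1) ^ (k + 1) * (2 * Real.pi) ^ (2 * k + 2) / ((2 * k + 1).factorial : ℂ) *
      ∑' n : ℕ+, ((n : ℕ) : ℂ) ^ (2 * k + 1) * q T ^ ((m : ℕ) * (n : ℕ)) := by
    have him : 0 < (((m : ℕ) : ℤ) * T).im := by
      rw [Int.cast_natCast, ← Complex.ofReal_natCast, Complex.im_ofReal_mul]
      exact mul_pos (by exact_mod_cast m.pos) hTim
    simp only [hc, intSum_eq_tsum_pnat k him]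
    congr 1
    refine tsum_congr fun n => ?_
    rw [q, ← Complex.exp_nat_mul, ← Complex.exp_nat_mul]
    congr 2
    push_cast
    ring
  have hsum0 := summable_pow_mul_bounded (norm_q_lt_one hTim) (2 * k + 1)
    (fun _ => 1) (C := 1) (fun p => by simp)
  have hcs : Summable fun m : ℕ => c m := by
    rw [← summable_pnat_iff_summable_nat]
    simp only [hcpos]
    have h := hsum0.prod
    simp only [mul_one] at h
    exact h.mul_left _
  have hχc : Summable fun m : ℕ => χ (m : ZMod N) * c m := by
    refine Summable.of_norm_bounded hcs.norm fun m => ?_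
    rw [norm_mul]
    exact mul_le_of_le_one_left (norm_nonneg _) (χ.norm_le_one _)
  have hsub (r : ℕ) : Summable fun j : ℕ => c (r + N * j) := by
    have h := hcs.comp_injective (i := fun j : ℕ => r + N * j) fun a b hab => by
      have : N * a = N * b := by simpa using hab
      exact Nat.eq_of_mul_eq_mul_left (by omega) this
    refine h.congr fun j => ?_
    simp
  have hYn : HasSum (fun j : ℕ => Y j) (∑' M : ℕ, χ (M : ZMod N) * c M) := by
    rw [← sum_char_mul_tsum hN χ (fun M => c M) hχc]
    refine hasSum_sum fun r _ => HasSum.mul_left _ ?_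
    simpa using (hsub r).hasSum
  -- The same reflection exchanges the columns with indices `-(j + 1)` and `j`, so only the
  -- columns with `m > 0` have to be summed.
  have hYneg (j : ℕ) : Y (-(j + 1)) = Y j := by
    simp only [hY]
    rw [← sum_char_mul_reflect hχ fun r : ℕ => c (r + N * j)]
    refine Finset.sum_congr rfl fun r hr => ?_
    rw [Finset.mem_Icc] at hr
    rw [← hcneg, Nat.cast_sub (by omega)]
    congr 2
    ring
  have hYZ : HasSum Y (∑' M : ℕ, χ (M : ZMod N) * c M + ∑' M : ℕ, χ (M : ZMod N) * c M) :=
    HasSum.of_nat_of_neg_add_one hYn (by simpa only [hYneg] using hYn)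
  have hsum := summable_pow_mul_bounded (norm_q_lt_one hTim) (2 * k + 1)
    (fun p => χ ((p.1 : ℕ) : ZMod N)) (fun p => χ.norm_le_one _)
  rw [hYV.unique (hYZ.mul_left _), tsum_char_mul_eq_tsum_pnat hN χ (fun M => c M) hχc]
  simp only [hcpos]
  rw [eisE, hsum.tsum_prod]
  have hin (m : ℕ+) : χ ((m : ℕ) : ZMod N) * ((-1) ^ (k + 1) * (2 * Real.pi) ^ (2 * k + 2) /
      ((2 * k + 1).factorial : ℂ) *
      ∑' n : ℕ+, ((n : ℕ) : ℂ) ^ (2 * k + 1) * q T ^ ((m : ℕ) * (n : ℕ))) =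
      (-1) ^ (k + 1) * (2 * Real.pi) ^ (2 * k + 2) / ((2 * k + 1).factorial : ℂ) *
      ∑' n : ℕ+, ((n : ℕ) : ℂ) ^ (2 * k + 1) * χ ((m : ℕ) : ZMod N) *
        q T ^ ((m : ℕ) * (n : ℕ)) := by
    rw [mul_left_comm, ← tsum_mul_left]
    congr 1
    exact tsum_congr fun n => by ring
  simp only [hin]
  rw [tsum_mul_left]
  ring

/-! ### The Weierstrass function -/

/-- The Taylor coefficient of degree `i` of `∑ χ(r) ℘(z + rπ/N | τ)` at `z = 0`. -/
def wpCoeff {N : ℕ} (χ : DirichletCharacter ℂ N) (τ : UpperHalfPlane) (i : ℕ) : ℂ :=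
  ∑ r ∈ Finset.Icc 1 (N - 1), χ (r : ZMod N) *
    ((periods τ).weierstrassPSeries (r * Real.pi / N)).coeff i

/-- The parametrization `(m, n) ↦ -π(m + nτ)` of the lattice; the sign turns the differences
`l - rπ/N` of the expansion of `℘` into the points `-π(r/N + m + nτ)`. -/
def latticeEquiv (τ : UpperHalfPlane) : ℤ × ℤ ≃ (periods τ).lattice :=
  (Equiv.neg _).trans (periods τ).latticeEquivProd.symm.toEquiv

lemma latticeEquiv_apply (τ : UpperHalfPlane) (p : ℤ × ℤ) :
    ((latticeEquiv τ p : (periods τ).lattice) : ℂ) = -(Real.pi * (p.1 + p.2 * τ)) := by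
  have h := (periods τ).latticeEquiv_symm_apply (-p)
  have h2 : ((latticeEquiv τ p : (periods τ).lattice) : ℂ) =
    ((periods τ).latticeEquivProd.symm (-p) : ℂ) := rfl
  rw [h2, h]
  simp only [periods, Prod.fst_neg, Prod.snd_neg]
  push_cast
  ring

/-- The even Taylor coefficients are sums over the cells of the lattice. For `k = 0` the terms
`1 / l²` that make the series of `℘` converge cancel since `∑ χ(r) = 0`. -/
lemma hasSum_cellSum {N : ℕ} (hN : 2 ≤ N) (χ : DirichletCharacter ℂ N) (τ : UpperHalfPlane)
    (k : ℕ) (h : χ ≠ 1 ∨ 1 ≤ k) :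
    ∃ V, HasSum (cellSum χ τ (2 * k + 2)) V ∧
      wpCoeff χ τ (2 * k) = (2 * k + 1) * (V / (Real.pi : ℂ) ^ (2 * k + 2)) := by
  have hpi : (Real.pi : ℂ) ≠ 0 := by exact_mod_cast Real.pi_ne_zero
  have hterm (r : ℕ) (p : ℤ × ℤ) : (Real.pi : ℂ) ^ (2 * k + 2) *
      ((((latticeEquiv τ p : (periods τ).lattice) : ℂ) - r * Real.pi / N) ^ (2 * k + 2))⁻¹ =
      1 / ((r : ℂ) / N + p.1 + p.2 * τ) ^ (2 * k + 2) := by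
    have he : Even (2 * k + 2) := ⟨k + 1, by ring⟩
    rw [latticeEquiv_apply, show -((Real.pi : ℂ) * (p.1 + p.2 * τ)) - r * Real.pi / N =
      -(Real.pi * (r / N + p.1 + p.2 * τ)) by ring, he.neg_pow, mul_pow, mul_inv,
      mul_inv_cancel_left₀ (pow_ne_zero _ hpi), one_div]
  rcases Nat.eq_zero_or_pos k with rfl | hk
  · have hχ : χ ≠ 1 := h.resolve_right (by omega)
    refine ⟨(Real.pi : ℂ) ^ 2 * wpCoeff χ τ 0, ?_, by
      rw [mul_zero, Nat.cast_zero, mul_zero, zero_add, zero_add, one_mul,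
        mul_div_cancel_left₀ _ (pow_ne_zero _ hpi)]⟩
    have h1 : HasSum (fun l : (periods τ).lattice => ∑ r ∈ Finset.Icc 1 (N - 1), χ (r : ZMod N) *
        (1 / ((r * Real.pi / N : ℂ) - l) ^ 2 - 1 / (l : ℂ) ^ 2)) (wpCoeff χ τ 0) := by
      refine hasSum_sum fun r _ => HasSum.mul_left _ ?_
      convert! (periods τ).hasSum_weierstrassP (r * Real.pi / N) using 1
      simp [PeriodPair.weierstrassPSeries]
    have h2 := ((latticeEquiv τ).hasSum_iff.mpr h1).mul_left ((Real.pi : ℂ) ^ 2)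
    refine h2.congr_fun fun p => ?_
    simp only [Function.comp_apply, cellSum, mul_sub, Finset.sum_sub_distrib]
    rw [← Finset.sum_mul, sum_char_eq_zero hN hχ, zero_mul, sub_eq_self.mpr (mul_zero _),
      Finset.mul_sum]
    refine Finset.sum_congr rfl fun r _ => ?_
    rw [← hterm, sub_sq_comm]
    ring
  · refine ⟨(Real.pi : ℂ) ^ (2 * k + 2) * ∑ r ∈ Finset.Icc 1 (N - 1), χ (r : ZMod N) *
      (periods τ).sumInvPow (r * Real.pi / N) (2 * k + 2), ?_, ?_⟩
    · have h1 : HasSum (fun l : (periods τ).lattice => ∑ r ∈ Finset.Icc 1 (N - 1),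
          χ (r : ZMod N) * (((l : ℂ) - r * Real.pi / N) ^ (2 * k + 2))⁻¹)
          (∑ r ∈ Finset.Icc 1 (N - 1), χ (r : ZMod N) *
            (periods τ).sumInvPow (r * Real.pi / N) (2 * k + 2)) :=
        hasSum_sum fun r _ => ((periods τ).hasSum_sumInvPow _ (by omega)).mul_left _
      have h2 := ((latticeEquiv τ).hasSum_iff.mpr h1).mul_left ((Real.pi : ℂ) ^ (2 * k + 2))
      refine h2.congr_fun fun p => ?_
      simp only [Function.comp_apply, cellSum, Finset.mul_sum]
      exact Finset.sum_congr rfl fun r _ => by rw [← hterm, mul_left_comm]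
    · rw [mul_div_cancel_left₀ _ (pow_ne_zero _ hpi), wpCoeff, Finset.mul_sum]
      refine Finset.sum_congr rfl fun r _ => ?_
      rw [PeriodPair.weierstrassPSeries, FormalMultilinearSeries.coeff_ofScalars,
        if_neg (by omega)]
      push_cast
      ring

lemma sumInvPow_neg_of_odd (L : PeriodPair) (x : ℂ) {n : ℕ} (hn : Odd n) :
    L.sumInvPow (-x) n = -L.sumInvPow x n := by
  rw [PeriodPair.sumInvPow, PeriodPair.sumInvPow, ← (Equiv.neg _).tsum_eq, ← tsum_neg]
  refine tsum_congr fun l => ?_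
  rw [← inv_neg, ← hn.neg_pow]
  simp [sub_eq_add_neg, add_comm]

lemma sumInvPow_add_coe (L : PeriodPair) (x : ℂ) (l₀ : L.lattice) (n : ℕ) :
    L.sumInvPow (x + l₀) n = L.sumInvPow x n := by
  rw [PeriodPair.sumInvPow, PeriodPair.sumInvPow, ← (Equiv.addRight l₀).tsum_eq]
  refine tsum_congr fun l => ?_
  simp

/-- The sum of the translates of `℘` is even, through the reflection `r ↦ N - r`. -/
lemma wpCoeff_odd {N : ℕ} (hN : 2 ≤ N) {χ : DirichletCharacter ℂ N} (hχ : χ.Even)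
    (τ : UpperHalfPlane) (k : ℕ) : wpCoeff χ τ (2 * k + 1) = 0 := by
  have hN0 : (N : ℂ) ≠ 0 := by rw [Nat.cast_ne_zero]; omega
  have h1 : wpCoeff χ τ (2 * k + 1) = (2 * k + 2) * ∑ r ∈ Finset.Icc 1 (N - 1),
      χ (r : ZMod N) * (periods τ).sumInvPow (r * Real.pi / N) (2 * k + 3) := by
    rw [wpCoeff, Finset.mul_sum]
    refine Finset.sum_congr rfl fun r _ => ?_
    rw [PeriodPair.weierstrassPSeries, FormalMultilinearSeries.coeff_ofScalars,
        if_neg (by omega)]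
    push_cast
    ring
  have h2 := sum_char_mul_reflect hχ fun r : ℕ =>
    (periods τ).sumInvPow (r * Real.pi / N) (2 * k + 3)
  have h3 (r : ℕ) (hr : r ∈ Finset.Icc 1 (N - 1)) :
      (periods τ).sumInvPow ((N - r : ℕ) * Real.pi / N) (2 * k + 3) =
        -(periods τ).sumInvPow (r * Real.pi / N) (2 * k + 3) := by
    rw [Finset.mem_Icc] at hr
    rw [← sumInvPow_neg_of_odd _ _ ⟨k + 1, by ring⟩,
      ← sumInvPow_add_coe _ (-(r * Real.pi / N : ℂ)) ⟨_, (periods τ).ω₁_mem_lattice⟩, Nat.cast_sub (by omega)]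
    congr 1
    simp only [periods]
    field_simp
    ring
  rw [Finset.sum_congr rfl fun r hr => by rw [h3 r hr, mul_neg], Finset.sum_neg_distrib] at h2
  rw [h1, self_eq_neg.mp h2.symm, mul_zero]

lemma mem_lattice_periods_iff {τ : UpperHalfPlane} {x : ℂ} :
    x ∈ (periods τ).lattice ↔ ∃ a b : ℤ, (Real.pi * a + Real.pi * τ * b : ℂ) = x := by
  rw [PeriodPair.mem_lattice]
  simp only [periods]
  exact exists_congr fun a => exists_congr fun b => by rw [mul_comm (a : ℂ), mul_comm (b : ℂ)]

/-- The condition on the disc in terms of lattice points: `l - rπ/N = π((Na - r)/N + bτ)`, and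
`χ(Na - r) = χ(r)`. -/
lemma InDisc.norm_lt {N : ℕ} (hN : 2 ≤ N) {χ : DirichletCharacter ℂ N} (hχ : χ.Even)
    {τ : UpperHalfPlane} {z : ℂ} (hz : InDisc χ τ z) {r : ℕ} (hr : χ (r : ZMod N) ≠ 0)
    (a b : ℤ) : ‖z‖ < ‖(Real.pi * a + Real.pi * τ * b : ℂ) - r * Real.pi / N‖ := by
  have hN0 : (N : ℂ) ≠ 0 := by rw [Nat.cast_ne_zero]; omega
  have h := hz (N * a - r) b (by
    push_cast
    rwa [ZMod.natCast_self, zero_mul, zero_sub, char_neg hχ])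
  convert! h using 2
  push_cast
  field_simp
  ring

/-- The Taylor expansion of `∑ χ(r) ℘(z + rπ/N | τ)` on the whole disc. -/
lemma hasSum_wp {N : ℕ} (hN : 2 ≤ N) {χ : DirichletCharacter ℂ N} (hχ : χ.Even)
    (τ : UpperHalfPlane) {z : ℂ} (hz : InDisc χ τ z) :
    HasSum (fun k : ℕ => wpCoeff χ τ (2 * k) * z ^ (2 * k))
      (∑ r ∈ Finset.Icc 1 (N - 1), χ (r : ZMod N) * wp (z + r * Real.pi / N) τ) := by
  have h : HasSum (fun i : ℕ => wpCoeff χ τ i * z ^ i)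
      (∑ r ∈ Finset.Icc 1 (N - 1), χ (r : ZMod N) * wp (z + r * Real.pi / N) τ) := by
    simp only [wpCoeff, Finset.sum_mul, mul_assoc]
    refine hasSum_sum fun r _ => ?_
    rcases eq_or_ne (χ (r : ZMod N)) 0 with h0 | h0
    · simp only [h0, zero_mul]
      exact hasSum_zero
    · refine HasSum.mul_left _ ?_
      have h1 := (periods τ).weierstrassPSeries_hasSum (z + r * Real.pi / N) (r * Real.pi / N)
        (fun l => by
          obtain ⟨a, b, hab⟩ := mem_lattice_periods_iff.mp l.2
          rw [add_sub_cancel_right, ← hab]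
          exact hz.norm_lt hN hχ h0 a b)
      simp only [add_sub_cancel_right] at h1
      exact h1
  refine (Function.Injective.hasSum_iff (g := fun k : ℕ => 2 * k) (fun a b hab => by
    simpa using hab) fun i hi => ?_).mpr h
  rcases Nat.even_or_odd' i with ⟨c, rfl | rfl⟩
  · exact absurd ⟨c, rfl⟩ hi
  · rw [wpCoeff_odd hN hχ, zero_mul]

/-! ### The absolutely convergent double series and the expansion of `g` at the origin -/

/-- For `k ≥ 1` the double series over all `m, n` converges absolutely, and it may be summed cell
by cell. -/
lemma hasSum_pairs {N : ℕ} (hN : 2 ≤ N) (χ : DirichletCharacter ℂ N) (τ : UpperHalfPlane)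
    {k : ℕ} (hk : 1 ≤ k) {V : ℂ} (hV : HasSum (cellSum χ τ (2 * k + 2)) V) :
    HasSum (fun p : ℤ × ℤ => χ (p.1 : ZMod N) / ((p.1 : ℂ) / N + p.2 * (τ : ℂ)) ^ (2 * k + 2))
      V := by
  have : NeZero N := ⟨by omega⟩
  have hN0 : (N : ℂ) ≠ 0 := by rw [Nat.cast_ne_zero]; omega
  have him : 0 < ((N : ℂ) * τ).im := by
    rw [← Complex.ofReal_natCast, Complex.im_ofReal_mul]
    exact mul_pos (by positivity) τ.im_pos
  have hS : Summable fun p : ℤ × ℤ =>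
      χ (p.1 : ZMod N) / ((p.1 : ℂ) / N + p.2 * (τ : ℂ)) ^ (2 * k + 2) := by
    have h1 := summable_prod_eisSummand (k := 2 * k + 2) (by omega) ⟨_, him⟩
    have h2 := ((Equiv.prodComm ℤ ℤ).summable_iff.mpr h1).norm.mul_left (‖(N : ℂ) ^ (2 * k + 2)‖)
    refine Summable.of_norm_bounded h2 fun p => ?_
    rw [← norm_mul, div_eq_mul_inv, norm_mul]
    refine (mul_le_of_le_one_left (norm_nonneg _) (χ.norm_le_one _)).trans (le_of_eq ?_)
    congr 1
    simp only [Function.comp_apply, EisensteinSeries.eisSummand]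
    rw [zpow_neg, zpow_natCast, ← inv_inj, mul_inv, inv_inv, inv_inv, ← inv_pow, ← mul_pow]
    congr 1
    simp
    field_simp
    ring
  have hA := hS.hasSum
  -- The equivalence `((j, n), r) ↦ (jN + r, n)`.
  set e : (ℤ × ℤ) × Fin N ≃ ℤ × ℤ := (Equiv.prodAssoc ℤ ℤ (Fin N)).trans
    (((Equiv.refl ℤ).prodCongr (Equiv.prodComm ℤ (Fin N))).trans
      ((Equiv.prodAssoc ℤ (Fin N) ℤ).symm.trans
        ((Int.divModEquiv N).symm.prodCongr (Equiv.refl ℤ))))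
  have h1 := (e.hasSum_iff.mpr hA).prod_fiberwise fun p => hasSum_fintype _
  have h2 : HasSum (cellSum χ τ (2 * k + 2)) (∑' p : ℤ × ℤ,
      χ (p.1 : ZMod N) / ((p.1 : ℂ) / N + p.2 * (τ : ℂ)) ^ (2 * k + 2)) := by
    refine h1.congr_fun fun p => ?_
    have hterm (r : Fin N) : ((fun p : ℤ × ℤ =>
        χ (p.1 : ZMod N) / ((p.1 : ℂ) / N + p.2 * (τ : ℂ)) ^ (2 * k + 2)) ∘ e) (p, r) =
        (fun r : ℕ => χ (r : ZMod N) * (1 / ((r : ℂ) / N + p.1 + p.2 * τ) ^ (2 * k + 2))) r := by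
      change χ ((p.1 * N + (r : ℕ) : ℤ) : ZMod N) /
        (((p.1 * N + (r : ℕ) : ℤ) : ℂ) / N + p.2 * (τ : ℂ)) ^ (2 * k + 2) = _
      push_cast
      rw [ZMod.natCast_self, mul_zero, zero_add, mul_one_div]
      congr 3
      field_simp
      ring
    simp only [hterm]
    rw [Fin.sum_univ_eq_sum_range (fun r : ℕ =>
      χ (r : ZMod N) * (1 / ((r : ℂ) / N + p.1 + p.2 * τ) ^ (2 * k + 2))),
      sum_range_char_mul hN χ fun r : ℕ => 1 / ((r : ℂ) / N + p.1 + p.2 * τ) ^ (2 * k + 2),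
      cellSum]
  rw [hV.unique h2]
  exact hA

lemma summable_char_mul_geomTail {N : ℕ} (χ : DirichletCharacter ℂ N) {T : ℂ} (hT : 0 < T.im)
    (x : ℂ) : Summable fun M : ℕ => χ (M : ZMod N) * geomTail (q T ^ M * x) := by
  refine Summable.of_norm_bounded (summable_geomTail (norm_q_lt_one hT) x).norm fun M => ?_
  rw [norm_mul]
  exact mul_le_of_le_one_left (norm_nonneg _) (χ.norm_le_one _)

/-- The Lambert series of `g(·|T; χ)` near `0`. The constants `-i` cancel since `∑ χ(k) = 0`. -/
lemma g_eq_tsum {N : ℕ} (hN : 2 ≤ N) {χ : DirichletCharacter ℂ N} (hχ : χ.Even) (hχ1 : χ ≠ 1)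
    {T w : ℂ} (hT : 0 < T.im) (hw : ‖w‖ < Real.pi * T.im) :
    g χ w T = -2 * I * ∑' M : ℕ, χ (M : ZMod N) * geomTail (q T ^ M * cexp (2 * I * w)) +
      2 * I * ∑' M : ℕ, χ (M : ZMod N) * geomTail (q T ^ M * cexp (-(2 * I * w))) := by
  have hNT : 0 < ((N : ℂ) * T).im := by
    rw [← Complex.ofReal_natCast, Complex.im_ofReal_mul]
    exact mul_pos (by exact_mod_cast (by omega)) hT
  have hqN : q (N * T) = q T ^ N := by
    rw [q, q, ← Complex.exp_nat_mul]; congr 1; ring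
  -- Modulo the period `πNT`, the imaginary part of `w + kπT` stays away from `0`.
  have hne (k : ℕ) (hk : k ∈ Finset.Icc 1 (N - 1)) :
      theta1 (w + k * Real.pi * T) (N * T) ≠ 0 := by
    intro h0
    rw [Finset.mem_Icc] at hk
    obtain ⟨a, b, hab⟩ := exists_of_theta1_eq_zero hNT h0
    have h1 : w.im = Real.pi * T.im * ((N * b - k : ℤ) : ℝ) := by
      have h2 : w = (Real.pi * a : ℝ) + (Real.pi * (N * b - k : ℤ) : ℝ) * T := by
        push_cast
        linear_combination hab
      rw [h2, Complex.add_im, Complex.ofReal_im, Complex.im_ofReal_mul]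
      ring
    have h3 : (N * b - k : ℤ) ≠ 0 := by
      intro h4
      have h5 : (N : ℤ) ∣ k := ⟨b, by linarith⟩
      have h6 := Nat.le_of_dvd (by omega) (Int.natCast_dvd_natCast.mp h5)
      omega
    have h4 : (1 : ℝ) ≤ |((N * b - k : ℤ) : ℝ)| := by exact_mod_cast Int.one_le_abs h3
    have h5 := Complex.abs_im_le_norm w
    rw [h1, abs_mul, abs_of_pos (mul_pos Real.pi_pos hT)] at h5
    have h6 := mul_pos Real.pi_pos hT
    nlinarith
  have hsum := summable_char_mul_geomTail χ hT
  have hk (k : ℕ) (hk : k ∈ Finset.Icc 1 (N - 1)) : theta1LogDeriv (w + k * Real.pi * T) (N * T) =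
      -I - 2 * I * ∑' j : ℕ, geomTail (q T ^ (k + N * j) * cexp (2 * I * w)) +
        2 * I * ∑' j : ℕ, geomTail (q T ^ ((N - k) + N * j) * cexp (-(2 * I * w))) := by
    rw [theta1LogDeriv_eq hNT (hne k hk)]
    rw [Finset.mem_Icc] at hk
    have e1 : cexp (2 * I * (w + k * Real.pi * T)) = q T ^ k * cexp (2 * I * w) := by
      rw [q, ← Complex.exp_nat_mul, ← Complex.exp_add]; congr 1; ring
    have e2 : cexp (-(2 * I * (w + k * Real.pi * T))) * q T ^ k = cexp (-(2 * I * w)) := by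
      rw [q, ← Complex.exp_nat_mul, ← Complex.exp_add]; congr 1; ring
    have s1 (j : ℕ) : q (N * T) ^ j * cexp (2 * I * (w + k * Real.pi * T)) =
        q T ^ (k + N * j) * cexp (2 * I * w) := by
      rw [e1, hqN]
      ring
    have s2 (j : ℕ) : q (N * T) ^ (j + 1) * cexp (-(2 * I * (w + k * Real.pi * T))) =
        q T ^ ((N - k) + N * j) * cexp (-(2 * I * w)) := by
      have h1 : q T ^ N = q T ^ (N - k) * q T ^ k := by rw [← pow_add]; congr 1; omega
      rw [← e2, hqN, pow_succ, ← pow_mul]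
      rw [h1]
      ring
    simp only [s1, s2]
  rw [g, Finset.sum_congr rfl fun k hk' => by rw [hk k hk']]
  simp only [mul_add, mul_sub, Finset.sum_add_distrib, Finset.sum_sub_distrib]
  rw [← Finset.sum_mul, sum_char_eq_zero hN hχ1,
    sum_char_mul_reflect hχ fun k : ℕ =>
      2 * I * ∑' j : ℕ, geomTail (q T ^ (k + N * j) * cexp (-(2 * I * w))),
    ← sum_char_mul_tsum hN χ _ (hsum _), ← sum_char_mul_tsum hN χ _ (hsum _), Finset.mul_sum,
    Finset.mul_sum, zero_mul, zero_sub, ← Finset.sum_neg_distrib]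
  congr 1 <;> exact Finset.sum_congr rfl fun k _ => by ring

lemma hasSum_geomTail {y : ℂ} (hy : ‖y‖ < 1) : HasSum (fun n : ℕ+ => y ^ (n : ℕ)) (geomTail y) := by
  have h := (hasSum_geometric_of_norm_lt_one hy).mul_left y
  have h2 : HasSum (fun n : ℕ => y ^ (n + 1)) (geomTail y) := by
    simpa [geomTail, pow_succ', div_eq_mul_inv] using h
  have h3 := Equiv.pnatEquivNat.hasSum_iff.mpr h2
  refine h3.congr_fun fun n => ?_
  simp [Equiv.pnatEquivNat]

/-- The term of degree `2k + 1` in the expansion of `χ(m) q^{mn} sin 2nw` in powers of `w`. -/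
def sinTerm {N : ℕ} (χ : DirichletCharacter ℂ N) (T w : ℂ) (x : (ℕ+ × ℕ+) × ℕ) : ℂ :=
  χ ((x.1.1 : ℕ) : ZMod N) * q T ^ ((x.1.1 : ℕ) * (x.1.2 : ℕ)) *
    ((-1) ^ x.2 * (2 * ((x.1.2 : ℕ) : ℂ) * w) ^ (2 * x.2 + 1) / ((2 * x.2 + 1).factorial : ℂ))

lemma hasSum_sinTerm {N : ℕ} (χ : DirichletCharacter ℂ N) (T w : ℂ) (p : ℕ+ × ℕ+) :
    HasSum (fun k => sinTerm χ T w (p, k)) (χ ((p.1 : ℕ) : ZMod N) *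
      q T ^ ((p.1 : ℕ) * (p.2 : ℕ)) * Complex.sin (2 * ((p.2 : ℕ) : ℂ) * w)) := by
  simp only [sinTerm]
  exact (Complex.hasSum_sin (2 * ((p.2 : ℕ) : ℂ) * w)).mul_left _

lemma summable_sinTerm {N : ℕ} (χ : DirichletCharacter ℂ N) {T w : ℂ} (hT : 0 < T.im)
    (hw : ‖q T‖ * Real.exp (2 * ‖w‖) < 1) : Summable (sinTerm χ T w) := by
  have hq := norm_q_lt_one hT
  have hbound (p : ℕ+ × ℕ+) : HasSum (fun k => ‖q T‖ ^ ((p.1 : ℕ) * (p.2 : ℕ)) *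
      ((2 * ((p.2 : ℕ) : ℝ) * ‖w‖) ^ (2 * k + 1) / ((2 * k + 1).factorial : ℝ)))
      (‖q T‖ ^ ((p.1 : ℕ) * (p.2 : ℕ)) * Real.sinh (2 * ((p.2 : ℕ) : ℝ) * ‖w‖)) :=
    (Real.hasSum_sinh _).mul_left _
  have h1 : Summable fun x : (ℕ+ × ℕ+) × ℕ => ‖q T‖ ^ ((x.1.1 : ℕ) * (x.1.2 : ℕ)) *
      ((2 * ((x.1.2 : ℕ) : ℝ) * ‖w‖) ^ (2 * x.2 + 1) / ((2 * x.2 + 1).factorial : ℝ)) := by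
    refine (summable_prod_of_nonneg fun x => by simp only [Pi.zero_apply]; positivity).mpr
      ⟨fun p => (hbound p).summable, ?_⟩
    simp only [(hbound _).tsum_eq]
    have h2 : Summable fun m : ℕ+ => ‖q T‖ ^ m.natPred :=
      (summable_geometric_of_lt_one (norm_nonneg _) hq).comp_injective PNat.natPred_injective
    have h3 : Summable fun n : ℕ+ => (‖q T‖ * Real.exp (2 * ‖w‖)) ^ (n : ℕ) :=
      (summable_geometric_of_lt_one (by positivity) hw).comp_injective PNat.coe_injective
    refine Summable.of_nonneg_of_le (fun p => ?_) (fun p => ?_) (h2.mul_of_nonneg h3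
      (fun _ => by simp only [Pi.zero_apply]; positivity)
      (fun _ => by simp only [Pi.zero_apply]; positivity))
    · exact mul_nonneg (by positivity) (Real.sinh_nonneg_iff.mpr (by positivity))
    · have h4 := pow_mul_le_pow_natPred_mul (norm_nonneg (q T)) hq.le p.1 p.2
      have h5 : Real.sinh (2 * ((p.2 : ℕ) : ℝ) * ‖w‖) ≤ Real.exp (2 * ‖w‖) ^ (p.2 : ℕ) := by
        rw [← Real.exp_nat_mul, Real.sinh_eq,
          show ((p.2 : ℕ) : ℝ) * (2 * ‖w‖) = 2 * ((p.2 : ℕ) : ℝ) * ‖w‖ by ring]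
        have := Real.exp_pos (2 * ((p.2 : ℕ) : ℝ) * ‖w‖)
        have := Real.exp_pos (-(2 * ((p.2 : ℕ) : ℝ) * ‖w‖))
        linarith
      rw [mul_pow, ← mul_assoc]
      exact mul_le_mul h4 h5 (Real.sinh_nonneg_iff.mpr (by positivity)) (by positivity)
  refine Summable.of_norm_bounded h1 fun x => ?_
  simp only [sinTerm, norm_mul, norm_div, norm_pow, norm_neg, norm_one, one_pow, one_mul,
    Complex.norm_natCast, Complex.norm_two]
  rw [mul_assoc]
  exact mul_le_of_le_one_left (by positivity) (χ.norm_le_one _)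

/-- Pairing the terms `e^{2inw}` and `e^{-2inw}` of the Lambert series gives sines. -/
lemma g_eq_tsum_sinTerm {N : ℕ} (hN : 2 ≤ N) {χ : DirichletCharacter ℂ N} (hχ : χ.Even)
    (hχ1 : χ ≠ 1) {T w : ℂ} (hT : 0 < T.im) (hw : ‖w‖ < Real.pi * T.im)
    (hw1 : ‖q T‖ * Real.exp (2 * ‖w‖) < 1) : g χ w T = 4 * ∑' x, sinTerm χ T w x := by
  have hq := norm_q_lt_one hT
  have hexp (u : ℂ) (hu : ‖u‖ = 2 * ‖w‖) (M : ℕ+) : ‖q T ^ (M : ℕ) * cexp u‖ < 1 := by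
    rw [norm_mul, norm_pow]
    refine lt_of_le_of_lt ?_ hw1
    have h1 := Complex.norm_exp_le_exp_norm u
    rw [hu] at h1
    have h2 : ‖q T‖ ^ (M : ℕ) ≤ ‖q T‖ := pow_le_of_le_one (norm_nonneg _) hq.le M.ne_zero
    gcongr
  have hps := (summable_sinTerm χ hT hw1).hasSum.prod_fiberwise (hasSum_sinTerm χ T w)
  have hsum (x : ℂ) : Summable fun M : ℕ+ =>
      χ ((M : ℕ) : ZMod N) * geomTail (q T ^ (M : ℕ) * x) :=
    summable_pnat_iff_summable_nat.mpr (summable_char_mul_geomTail χ hT x)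
  have h2w : ‖2 * I * w‖ = 2 * ‖w‖ := by simp
  rw [g_eq_tsum hN hχ hχ1 hT hw, ← hps.tsum_eq, hps.summable.tsum_prod,
    tsum_char_mul_eq_tsum_pnat hN χ _ (summable_char_mul_geomTail χ hT _),
    tsum_char_mul_eq_tsum_pnat hN χ _ (summable_char_mul_geomTail χ hT _),
    ← tsum_mul_left, ← tsum_mul_left, ← tsum_mul_left,
    ← Summable.tsum_add ((hsum _).mul_left _) ((hsum _).mul_left _)]
  refine tsum_congr fun M => ?_
  have h1 := hasSum_geomTail (hexp (2 * I * w) h2w M)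
  have h2 := hasSum_geomTail (hexp (-(2 * I * w)) (by rw [norm_neg, h2w]) M)
  have h3 := ((h1.mul_left (χ ((M : ℕ) : ZMod N))).mul_left (-2 * I)).add
    ((h2.mul_left (χ ((M : ℕ) : ZMod N))).mul_left (2 * I))
  rw [← h3.tsum_eq, ← tsum_mul_left]
  refine tsum_congr fun n => ?_
  rw [Complex.sin, mul_pow, mul_pow, ← pow_mul, ← Complex.exp_nat_mul, ← Complex.exp_nat_mul,
    show 2 * ((n : ℕ) : ℂ) * w * I = (n : ℕ) * (2 * I * w) by ring,
    show -(2 * ((n : ℕ) : ℂ) * w) * I = (n : ℕ) * -(2 * I * w) by ring]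
  ring

/-- The Taylor expansion of `g(·|T; χ)` near `0`. -/
lemma eventually_hasSum_g {N : ℕ} (hN : 2 ≤ N) {χ : DirichletCharacter ℂ N} (hχ : χ.Even)
    (hχ1 : χ ≠ 1) {T : ℂ} (hT : 0 < T.im) :
    ∀ᶠ w in 𝓝 (0 : ℂ), HasSum (fun k : ℕ => -(eisE χ T k * w ^ (2 * k + 1))) (g χ w T) := by
  have hc : Tendsto (fun w : ℂ => ‖q T‖ * Real.exp (2 * ‖w‖)) (𝓝 0) (𝓝 (‖q T‖)) := by
    have h : ContinuousAt (fun w : ℂ => ‖q T‖ * Real.exp (2 * ‖w‖)) 0 := by fun_prop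
    simpa using h.tendsto
  have hc2 : Tendsto (fun w : ℂ => ‖w‖) (𝓝 0) (𝓝 0) := by
    simpa using (continuous_norm (E := ℂ)).tendsto 0
  filter_upwards [hc.eventually_lt_const (norm_q_lt_one hT),
    hc2.eventually_lt_const (mul_pos Real.pi_pos hT)] with w hw1 hw2
  have hts := (Equiv.prodComm ℕ (ℕ+ × ℕ+)).summable_iff.mpr (summable_sinTerm χ hT hw1)
  have hks := (hts.hasSum.prod_fiberwise fun k => (hts.prod_factor k).hasSum).mul_left 4
  have hswap : ∑' x, (sinTerm χ T w ∘ Equiv.prodComm ℕ (ℕ+ × ℕ+)) x = ∑' x, sinTerm χ T w x :=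
    (Equiv.prodComm ℕ (ℕ+ × ℕ+)).tsum_eq (sinTerm χ T w)
  rw [hswap, ← g_eq_tsum_sinTerm hN hχ hχ1 hT hw2 hw1] at hks
  refine hks.congr_fun fun k => ?_
  simp only [sinTerm, Function.comp_apply, Equiv.prodComm_apply, Prod.swap_prod_mk]
  rw [eisE, ← tsum_mul_left, ← tsum_mul_left, ← tsum_mul_right, ← tsum_neg]
  refine tsum_congr fun p => ?_
  rw [mul_pow, mul_pow]
  ring

/-- A power series expansion valid near `0` remains valid on every disc where the function is
holomorphic. -/
lemma hasSum_of_eventually_hasSum {f : ℂ → ℂ} {a : ℕ → ℂ} {U : Set ℂ} (hU : IsOpen U)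
    (hf : DifferentiableOn ℂ f U) {z : ℂ} (hz : Metric.closedBall 0 ‖z‖ ⊆ U)
    (h : ∀ᶠ w in 𝓝 (0 : ℂ), HasSum (fun i => a i * w ^ i) (f w)) :
    HasSum (fun i => a i * z ^ i) (f z) := by
  obtain ⟨δ, hδ, hsub⟩ := (isCompact_closedBall (0 : ℂ) ‖z‖).exists_cthickening_subset_open hU hz
  rw [cthickening_closedBall hδ.le (norm_nonneg _)] at hsub
  obtain ⟨R, hR⟩ : ∃ R : NNReal, (R : ℝ) = δ + ‖z‖ := ⟨⟨δ + ‖z‖, by positivity⟩, rfl⟩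
  rw [← hR] at hsub
  have h1 : HasFPowerSeriesAt f (FormalMultilinearSeries.ofScalars ℂ a) 0 := by
    rw [hasFPowerSeriesAt_iff]
    refine h.mono fun w hw => ?_
    simpa [FormalMultilinearSeries.coeff_ofScalars, mul_comm] using hw
  obtain ⟨r₁, h1⟩ := h1
  have h2 := (hf.mono hsub).hasFPowerSeriesOnBall (by
    rw [← NNReal.coe_pos, hR]; positivity)
  have h3 := (h1.exchange_radius h2).hasSum (y := z) (by
    rw [Metric.eball_coe, mem_ball_zero_iff, hR]
    linarith)
  simpa [FormalMultilinearSeries.apply_eq_pow_smul_coeff, FormalMultilinearSeries.coeff_ofScalars, mul_comm] using h3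

/-! ### Holomorphy of `g` on the disc and the conclusion -/

/-- The Taylor expansion of `τ⁻¹ g(z/τ | -1/(Nτ); χ)` on the whole disc: the poles are the points
`rπ/N + l` with `χ(r) ≠ 0` and `l` in the lattice, and they lie outside the disc. -/
lemma hasSum_g {N : ℕ} (hN : 2 ≤ N) {χ : DirichletCharacter ℂ N} (hχ : χ.Even)
    (hχ1 : χ ≠ 1) (τ : UpperHalfPlane)
    {z : ℂ} (hz : InDisc χ τ z) :
    HasSum (fun k : ℕ => -(1 / (τ : ℂ) ^ (2 * k + 2) * eisE χ (-1 / (N * (τ : ℂ))) k *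
      z ^ (2 * k + 1))) (1 / (τ : ℂ) * g χ (z / (τ : ℂ)) (-1 / (N * (τ : ℂ)))) := by
  have hN0 : (N : ℂ) ≠ 0 := by rw [Nat.cast_ne_zero]; omega
  have hτ0 : (τ : ℂ) ≠ 0 := UpperHalfPlane.ne_zero τ
  set T : ℂ := -1 / (N * (τ : ℂ)) with hT
  have hTim : 0 < T.im := im_neg_one_div_mul_pos hN τ
  have hNT : (N : ℂ) * T = -1 / τ := by rw [hT]; field_simp
  have hNTim : 0 < ((N : ℂ) * T).im := by
    rw [← Complex.ofReal_natCast, Complex.im_ofReal_mul]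
    exact mul_pos (by positivity) hTim
  set U : Set ℂ := ⋂ r ∈ Finset.Icc 1 (N - 1), {w : ℂ | χ (r : ZMod N) ≠ 0 →
    w - r * Real.pi / N ∈ ((periods τ).lattice : Set ℂ)ᶜ} with hU
  have hUopen : IsOpen U := by
    refine isOpen_biInter_finset fun r _ => ?_
    by_cases h : χ (r : ZMod N) = 0
    · simp [h]
    · simp only [ne_eq, h, not_false_eq_true, forall_const]
      exact (periods τ).isClosed_lattice.isOpen_compl.preimage
        (f := fun w : ℂ => w - r * Real.pi / N) (by fun_prop)
  have hball : Metric.closedBall 0 ‖z‖ ⊆ U := by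
    intro w hw
    rw [mem_closedBall_zero_iff] at hw
    simp only [hU, Set.mem_iInter, Set.mem_ofPred_eq]
    intro r _ hr hmem
    obtain ⟨a, b, hab⟩ := mem_lattice_periods_iff.mp hmem
    have h := hz.norm_lt hN hχ hr (-a) (-b)
    rw [show ((Real.pi : ℂ) * (-a : ℤ) + Real.pi * τ * (-b : ℤ)) - r * Real.pi / N = -w by
      push_cast; linear_combination -hab, norm_neg] at h
    linarith
  have hdiff : DifferentiableOn ℂ (fun w => 1 / (τ : ℂ) * g χ (w / (τ : ℂ)) T) U := by
    intro w hw
    refine DifferentiableAt.differentiableWithinAt (DifferentiableAt.const_mul ?_ _)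
    unfold g
    refine DifferentiableAt.fun_sum fun r hr => ?_
    simp only [hU, Set.mem_iInter, Set.mem_ofPred_eq] at hw
    by_cases h : χ (r : ZMod N) = 0
    · simp [h]
    refine DifferentiableAt.const_mul ?_ _
    have hθ : theta1 (w / τ + r * Real.pi * T) (N * T) ≠ 0 := by
      intro h0
      obtain ⟨a, b, hab⟩ := exists_of_theta1_eq_zero hNTim h0
      refine hw r hr h (mem_lattice_periods_iff.mpr ⟨-b, a, ?_⟩)
      rw [hNT, hT] at hab
      field_simp at hab
      push_cast
      field_simp
      linear_combination -hab
    exact DifferentiableAt.comp (g := fun u => theta1LogDeriv u (N * T)) w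
      (theta1LogDeriv_differentiableAt hNTim hθ) (by fun_prop)
  -- The odd power series, written with a coefficient in every degree.
  set a : ℕ → ℂ := fun i => if i % 2 = 1 then
    -(1 / (τ : ℂ) ^ (2 * (i / 2) + 2) * eisE χ T (i / 2)) else 0 with ha
  have hodd (w : ℂ) (S : ℂ) : HasSum (fun i => a i * w ^ i) S ↔
      HasSum (fun k : ℕ => -(1 / (τ : ℂ) ^ (2 * k + 2) * eisE χ T k * w ^ (2 * k + 1))) S := by
    rw [← Function.Injective.hasSum_iff (g := fun k : ℕ => 2 * k + 1) (fun x y hxy => by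
      simpa using hxy) fun i hi => ?_]
    · refine iff_of_eq (congrArg (HasSum · S) (funext fun k => ?_))
      simp only [ha, Function.comp_apply]
      rw [if_pos (by omega), show (2 * k + 1) / 2 = k by omega]
      ring
    · simp only [ha]
      rw [if_neg, zero_mul]
      intro h
      exact hi ⟨i / 2, by simp only; omega⟩
  rw [← hodd]
  refine hasSum_of_eventually_hasSum (f := fun w => 1 / (τ : ℂ) * g χ (w / (τ : ℂ)) T)
    hUopen hdiff hball ?_
  have hlim : Tendsto (fun w : ℂ => w / (τ : ℂ)) (𝓝 0) (𝓝 0) := by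
    have h : ContinuousAt (fun w : ℂ => w / (τ : ℂ)) 0 := by fun_prop
    simpa using h.tendsto
  filter_upwards [hlim.eventually (eventually_hasSum_g hN hχ hχ1 hTim)] with w hw
  rw [hodd]
  refine (hw.mul_left (1 / (τ : ℂ))).congr_fun fun k => ?_
  rw [div_pow]
  field_simp
  ring

end

end EvenChar

theorem mainTheorem4 (N : ℕ) (hN : 2 ≤ N) (χ : DirichletCharacter ℂ N) (hχ : χ.Even)
    (τ : UpperHalfPlane) :
    (χ ≠ 1 →
      (∀ z : ℂ, EvenChar.InDisc χ τ z →
        HasSum (fun k : ℕ => -(EvenChar.eisF χ τ k * z ^ (2 * k + 1)))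
          (1 / (τ : ℂ) * EvenChar.g χ (z / (τ : ℂ)) (-1 / (N * (τ : ℂ))))) ∧
      (∀ z : ℂ, EvenChar.InDisc χ τ z →
        HasSum (fun k : ℕ => (2 * (k : ℂ) + 1) * EvenChar.eisF χ τ k * z ^ (2 * k))
          (∑ k ∈ Finset.Icc 1 (N - 1),
            χ (k : ZMod N) * EvenChar.wp (z + k * Real.pi / N) τ)) ∧
      (∀ k : ℕ, EvenChar.eisF χ τ k =
        1 / (τ : ℂ) ^ (2 * k + 2) * EvenChar.eisE χ (-1 / (N * (τ : ℂ))) k)) ∧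
    (∀ k : ℕ, 1 ≤ k →
      HasSum (fun p : ℤ × ℤ =>
          1 / (Real.pi : ℂ) ^ (2 * k + 2) *
            (χ (p.1 : ZMod N) / ((p.1 : ℂ) / N + p.2 * (τ : ℂ)) ^ (2 * k + 2)))
        (EvenChar.eisF χ τ k) ∧
      EvenChar.eisF χ τ k =
        1 / (τ : ℂ) ^ (2 * k + 2) * EvenChar.eisE χ (-1 / (N * (τ : ℂ))) k) := by
  have hpi (n : ℕ) : (Real.pi : ℂ) ^ n ≠ 0 := pow_ne_zero _ (by exact_mod_cast Real.pi_ne_zero)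
  have hFE (k : ℕ) (h : χ ≠ 1 ∨ 1 ≤ k) : EvenChar.eisF χ τ k =
      1 / (τ : ℂ) ^ (2 * k + 2) * EvenChar.eisE χ (-1 / (N * (τ : ℂ))) k := by
    obtain ⟨V, hV, _⟩ := EvenChar.hasSum_cellSum hN χ τ k h
    exact mul_left_cancel₀ (hpi (2 * k + 2)) ((EvenChar.eq_eisF_of_hasSum hN hχ τ k hV).symm.trans
      (EvenChar.eq_eisE_of_hasSum hN hχ τ k hV))
  refine ⟨fun hχ1 => ⟨fun z hz => ?_, fun z hz => ?_, fun k => hFE k (Or.inl hχ1)⟩,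
    fun k hk => ⟨?_, hFE k (Or.inr hk)⟩⟩
  · simp only [hFE _ (Or.inl hχ1)]
    exact EvenChar.hasSum_g hN hχ hχ1 τ hz
  · refine (EvenChar.hasSum_wp hN hχ τ hz).congr_fun fun k => ?_
    obtain ⟨V, hV, hc⟩ := EvenChar.hasSum_cellSum hN χ τ k (Or.inl hχ1)
    rw [hc, EvenChar.eq_eisF_of_hasSum hN hχ τ k hV, mul_div_cancel_left₀ _ (hpi _)]
  · obtain ⟨V, hV, _⟩ := EvenChar.hasSum_cellSum hN χ τ k (Or.inr hk)
    have h := (EvenChar.hasSum_pairs hN χ τ hk hV).mul_left (1 / (Real.pi : ℂ) ^ (2 * k + 2))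
    rwa [EvenChar.eq_eisF_of_hasSum hN hχ τ k hV, ← mul_assoc, one_div_mul_cancel (hpi _),
      one_mul] at h
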